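/- Let $a>0$. Write $\|f\|_s^2=\int_{\mathbb R}(1+\xi^2)^s|\hat f(\xi)|^2\,d\xi$ for the norm of the Sobolev space $H^s(\mathbb R)$ of real-valued functions ($\hat f$ the unitary Fourier transform), and put $$\psi(t,x)=\varphi(x)\bigl(1-e^{-t/\varphi(x)}\bigr),\qquad \varphi(x)=\ln(x^2+2).$$ Let $\{e_i\}_{i\ge1}$ be an orthonormal basis of $L^2(\mathbb R)$ and let $P_N$ be the orthogonal projection of $L^2(\mathbb R)$ onto $\mathrm{span}\{e_1,\dots,e_N\}$. Let $h\in L^2(\mathbb R)$, let $b_i\in\mathbb R$ with $\sum_i b_i^2<\infty$, let $\beta_i$ be independent standard real Brownian motions on a probability space, and let $\eta=\partial_tW$ with $W(t)=\sum_i b_i\beta_i(t)e_i$. Let $u,v$ be solutions on $[0,\infty)\times\mathbb R$ of $$u_t+au+u_{xxxx}+uu_x=h+\eta,\qquad v_t+av+v_{xxxx}+vv_x+P_N(uu_x-vv_x)=h+\eta,$$ that is, almost surely their paths lie in $C([0,\infty);H^1(\mathbb R))\cap L^2_{loc}([0,\infty);H^2(\mathbb R))$ and satisfy the equations integrated in time,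 in the sense of distributions in $x$. Put $w=u-v$. (1) There is a constant $C>0$, depending only on $a$, such that for every $N\ge1$ and all such data and solutions, almost surely, for all $t\ge s\ge0$, $$\|w(t)\|_1^2\le\|w(s)\|_1^2\exp\Bigl(-a(t-s)+C\int_s^t\bigl(\|u(r)\|_1^2+\|v(r)\|_1^2\bigr)dr\Bigr).$$ (2) There is a constant $C_*>0$, depending only on $a$, such that for every basis $\{e_i\}$ and every $\varepsilon>0$ there are a time $T>0$ and an integer $N\ge1$ such that, for all such $h$, $b_i$, $\beta_i$ and all solutions $u,v$ of the two equations with this $N$, almost surely, for all $t\ge s\ge0$, $$\|w(t+T)\|_1^2\le\|w(s+T)\|_1^2\exp\Bigl(-a(t-s)+C_*\varepsilon\int_{s+T}^{t+T}\bigl(\|u(r)\|_2^2+\|v(r)\|_2^2+\|\psi(r,\cdot)u(r)\|_1^2+\|\psi(r,\cdot)v(r)\|_1^2\bigr)dr\Bigr).$$ -/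

import Mathlib

open MeasureTheory ProbabilityTheory Filter Topology
open scoped ENNReal NNReal SchwartzMap FourierTransform

namespace KSE

noncomputable section

/-- The real Hilbert space `H = L²(ℝ)`. -/
abbrev L2 : Type := Lp ℝ 2 (volume : Measure ℝ)

/-- A real `L²` function regarded as a complex-valued one. -/
def toComplex (f : L2) : Lp ℂ 2 (volume : Measure ℝ) :=
  Complex.ofRealCLM.compLp f

/-- The squared Sobolev norm of order `s`, with value `∞` when `f ∉ H^s(ℝ)`. Mathlib's `𝓕` uses
the kernel `exp (-2π i x ξ)`; the weight `(1 + (2πξ)²)^s` makes this equal to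
`∫ (1 + |η|²)^s |û(η)|² dη` for the unitary transform with kernel `(2π)^(-1/2) exp (-i x η)`, so
that the square of the norm of order `1` is `‖f‖² + ‖f_x‖²`. -/
def eSobolevSq (s : ℝ) (f : L2) : ℝ≥0∞ :=
  ∫⁻ ξ : ℝ, ENNReal.ofReal ((1 + (2 * Real.pi * ξ) ^ 2) ^ s) *
    ‖(𝓕 (toComplex f) : Lp ℂ 2 (volume : Measure ℝ)) ξ‖ₑ ^ 2

/-- The Sobolev norm `‖f‖_s` as a real number (meaningful when `f ∈ H^s(ℝ)`). -/
def sobolevNorm (s : ℝ) (f : L2) : ℝ :=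
  Real.sqrt (eSobolevSq s f).toReal

open Classical in
/-- The element of `L²(ℝ)` represented by a square integrable function `f` (`0` for other `f`). -/
def toL2 (f : ℝ → ℝ) : L2 :=
  if hf : MemLp f 2 (volume : Measure ℝ) then hf.toLp f else 0

/-- `g` is the weak derivative of `f`: integration by parts holds against all test functions. -/
def HasWeakDeriv (f g : L2) : Prop :=
  ∀ φ : 𝓢(ℝ, ℝ), ∫ x, f x * deriv φ x = - ∫ x, g x * φ x

open Classical in
/-- The weak derivative `f_x`, for `f ∈ H¹(ℝ)` (`0` when there is no weak derivative in `L²`). -/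
def weakDeriv (f : L2) : L2 :=
  if hf : ∃ g : L2, HasWeakDeriv f g then hf.choose else 0

/-- The nonlinearity `f f_x`, which for `f ∈ H¹(ℝ)` lies in `L²(ℝ)`. -/
def convection (f : L2) : L2 :=
  toL2 (fun x => f x * weakDeriv f x)

/-- The orthogonal projection `P_N` of `L²(ℝ)` onto the span of the first `N` basis vectors
(numbered from `0`). -/
def proj (e : HilbertBasis ℕ ℝ L2) (N : ℕ) : L2 →L[ℝ] L2 :=
  haveI : FiniteDimensional ℝ (Submodule.span ℝ (Set.range fun i : Fin N => e i)) :=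
    FiniteDimensional.span_of_finite ℝ (Set.finite_range _)
  (Submodule.span ℝ (Set.range fun i : Fin N => e i)).starProjection

/-- `φ(x) = ln (x² + 2)`. -/
def phi (x : ℝ) : ℝ := Real.log (x ^ 2 + 2)

/-- The space-time weight `ψ(t, x) = φ(x) (1 - exp (-t / φ(x)))`. -/
def psi (t x : ℝ) : ℝ := phi x * (1 - Real.exp (-(t / phi x)))

/-- The function `ψ(t, ·) f`; for `t ≥ 0` it is in `L²(ℝ)` because `0 ≤ ψ(t, ·) ≤ t`. -/
def psiMul (t : ℝ) (f : L2) : L2 :=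
  toL2 (fun x => psi t x * f x)

/-- The Wiener process `W(t) = ∑ᵢ bᵢ βᵢ(t) eᵢ` in `L²(ℝ)`, at time `t ≥ 0` and sample point `ω`.
When `∑ᵢ bᵢ² < ∞` and the `βᵢ` are independent Brownian motions, the series converges in `L²(ℝ)`
for all `t ≥ 0`, almost surely. -/
def wiener {Ω : Type*} (e : HilbertBasis ℕ ℝ L2) (b : ℕ → ℝ) (β : ℕ → ℝ≥0 → Ω → ℝ)
    (t : ℝ) (ω : Ω) : L2 :=
  ∑' i, (b i * β i t.toNNReal ω) • e i

/-- The path `u` belongs to `C([0,∞); H¹(ℝ)) ∩ L²_loc([0,∞); H²(ℝ))`. -/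
structure IsRegularPath (u : ℝ → L2) : Prop where
  mem : ∀ t, 0 ≤ t → eSobolevSq 1 (u t) < ∞
  cont : ∀ t₀, 0 ≤ t₀ →
    Tendsto (fun t => eSobolevSq 1 (u t - u t₀)) (𝓝[Set.Ici 0] t₀) (𝓝 0)
  sq_integrable : ∀ T : ℝ, ∫⁻ r in Set.Ioc 0 T, eSobolevSq 2 (u r) < ∞

/-- The path `u` solves `u_t + a u + u_xxxx + u u_x + g = h + ∂_t W` on `[0,∞) × ℝ`, integrated in
time and in the sense of distributions in `x`; the path `W`, which vanishes at time `0`, is the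
time integral of the noise, and `g` is a further term of the equation. -/
def SolvesKSE (a : ℝ) (h : L2) (W g : ℝ → L2) (u : ℝ → L2) : Prop :=
  IsRegularPath u ∧
  ∀ φ : 𝓢(ℝ, ℝ), ∀ t, 0 ≤ t →
    ∫ x, u t x * φ x =
      (∫ x, u 0 x * φ x)
      - (∫ r in (0 : ℝ)..t,
          (a * (∫ x, u r x * φ x) + (∫ x, u r x * iteratedDeriv 4 φ x)
            + (∫ x, convection (u r) x * φ x) + ∫ x, g r x * φ x))
      + t * (∫ x, h x * φ x) + ∫ x, W t x * φ x

/-- The coupled pair on a probability space: `∑ᵢ bᵢ² < ∞`, the `βᵢ` are independent standard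
Brownian motions, and almost surely
`u_t + a u + u_xxxx + u u_x = h + η` and `v_t + a v + v_xxxx + v v_x + P_N (u u_x - v v_x) = h + η`
hold with the same white noise `η = ∂_t W`. -/
structure IsCoupledPair {Ω : Type*} [MeasurableSpace Ω] (P : Measure Ω) (a : ℝ)
    (e : HilbertBasis ℕ ℝ L2) (N : ℕ) (b : ℕ → ℝ) (h : L2) (β : ℕ → ℝ≥0 → Ω → ℝ)
    (u v : ℝ → Ω → L2) : Prop where
  summable : Summable (fun i => b i ^ 2)
  brownian : ∀ i, IsBrownianReal (β i) P
  indep : iIndepFun (fun i ω t => β i t ω) P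
  solves_u : ∀ᵐ ω ∂P, SolvesKSE a h (fun t => wiener e b β t ω) 0 (fun t => u t ω)
  solves_v : ∀ᵐ ω ∂P, SolvesKSE a h (fun t => wiener e b β t ω)
    (fun t => proj e N (convection (u t ω) - convection (v t ω))) (fun t => v t ω)

end

end KSE

/-!
The statement is pathwise: on the event where both equations hold the noise and the forcing cancel
in the difference `w = u - v` (`SolvesKSE.solvesLinear_sub`), which therefore solves the linear
equation `w_t + a w + w_xxxx + G = 0` with `G = (1 - P_N) (u u_x - v v_x)`.

The main ingredient is an energy inequality for that linear equation, `SolvesLinear.energy`: if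
`‖G‖ ≤ B ‖w‖₂` for almost all times and `B²` is integrable, then `‖w‖₁²` grows at most at the rate
`-a + (1 + 2 / a) B²`. Formally, `d/dt ‖w‖₁² + 2 (a ‖w‖₁² + ‖w_xx‖₁²) = -2 ⟨G, (1 - ∂ₓ²) w⟩`, the
right-hand side is at most `2 B ‖w‖₂²`, and `‖w‖₂²` interpolates between `‖w‖₁²` and the dissipation
(`dissipation_bound`). As `w` is only a weak solution, the computation is carried out for frequency
truncations of `w`, which solve an ordinary differential equation in `L²`
(`SolvesLinear.hasDerivAt_mulS`); the truncation is then removed by dominated convergence, and the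
rate is integrated by a Gronwall inequality with integrable coefficient (`gronwall_integral`).

What remains is to bound `G`. Polarization writes `u u_x - v v_x` as half of `w g_x + g w_x` with
`g = u + v`. For the first estimate `1 - P_N` is a contraction, and the Sobolev inequality gives
`B² = 16 (‖u‖₁² + ‖v‖₁²)` (`norm_convection_sub_le_sobolevNorm`). For the second estimate,
`u u_x - v v_x` is bounded in `H¹`, and in `L²` with the weight `ψ(t, ·)`, by `‖w‖₂` times the norms
of `u` and `v` under the integral. Since `ψ(t, x) → ∞` as `t` and `|x|` tend to infinity, a set that
is bounded in these norms is precompact in `L²`, so `1 - P_N` is small on it for large `N`, uniformly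
in large `t` (`exists_norm_sub_proj_le`). This makes `B²` at most `324 ε` times the integrand
(`exists_norm_convection_sub_sub_proj_le`).

The time integrals in the conclusion are taken of integrable functions: the norm of order one is
continuous along a regular path, and the others are measurable because Sobolev norms are lower
semicontinuous on `L²` (`lowerSemicontinuous_eSobolevSq`).
-/

namespace KSE

noncomputable section

/-! ### The Fourier transform of real square integrable functions -/

/-- Complex-valued `L²(ℝ)`. -/
abbrev CL2 : Type := Lp ℂ 2 (volume : Measure ℝ)

lemma toComplex_coeFn (f : L2) : toComplex f =ᵐ[volume] fun x => (f x : ℂ) :=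
  Complex.ofRealCLM.coeFn_compLp f

/-- The Fourier transform of a real `L²` function, as a continuous real-linear map. -/
def fhat : L2 →L[ℝ] CL2 :=
  ((Lp.fourierTransformₗᵢ ℝ ℂ).toContinuousLinearEquiv.toContinuousLinearMap.restrictScalars ℝ).comp
    (Complex.ofRealCLM.compLpL 2 volume)

lemma fhat_apply (f : L2) : fhat f = 𝓕 (toComplex f) := rfl

lemma norm_toComplex (f : L2) : ‖toComplex f‖ = ‖f‖ := by
  rw [Lp.norm_def, Lp.norm_def]
  congr 1
  apply eLpNorm_congr_norm_ae
  filter_upwards [toComplex_coeFn f] with x hx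
  rw [hx, Complex.norm_real]

lemma norm_fhat (f : L2) : ‖fhat f‖ = ‖f‖ := by
  rw [fhat_apply, Lp.norm_fourier_eq, norm_toComplex]

lemma integrable_mul_of_L2 {𝕜 : Type*} [RCLike 𝕜] {f g : ℝ → 𝕜} (hf : MemLp f 2 volume)
    (hg : MemLp g 2 volume) : Integrable (fun x => f x * g x) :=
  hf.integrable_mul hg

/-- The real part of a complex Schwartz function. -/
def schwartzRe : 𝓢(ℝ, ℂ) →L[ℝ] 𝓢(ℝ, ℝ) := SchwartzMap.postcompCLM (𝕜 := ℝ) Complex.reCLM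

/-- The imaginary part of a complex Schwartz function. -/
def schwartzIm : 𝓢(ℝ, ℂ) →L[ℝ] 𝓢(ℝ, ℝ) := SchwartzMap.postcompCLM (𝕜 := ℝ) Complex.imCLM

@[simp] lemma schwartzRe_apply (θ : 𝓢(ℝ, ℂ)) (x : ℝ) : schwartzRe θ x = (θ x).re := rfl
@[simp] lemma schwartzIm_apply (θ : 𝓢(ℝ, ℂ)) (x : ℝ) : schwartzIm θ x = (θ x).im := rfl

lemma deriv_schwartzRe (θ : 𝓢(ℝ, ℂ)) (x : ℝ) : deriv (schwartzRe θ) x = (deriv θ x).re := by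
  have h := Complex.reCLM.hasFDerivAt.comp_hasDerivAt x (θ.hasDerivAt x)
  exact h.deriv

lemma deriv_schwartzIm (θ : 𝓢(ℝ, ℂ)) (x : ℝ) : deriv (schwartzIm θ) x = (deriv θ x).im := by
  have h := Complex.imCLM.hasFDerivAt.comp_hasDerivAt x (θ.hasDerivAt x)
  exact h.deriv

lemma memLp_ofReal (f : L2) : MemLp (fun x => (f x : ℂ)) 2 volume :=
  (Lp.memLp f).ofReal

lemma integral_ofReal_mul_re (f : L2) (θ : 𝓢(ℝ, ℂ)) :
    (∫ x, (f x : ℂ) * θ x).re = ∫ x, f x * schwartzRe θ x := by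
  have := Complex.reCLM.integral_comp_comm
    (integrable_mul_of_L2 (memLp_ofReal f) (θ.memLp 2 volume))
  simp only [Complex.reCLM_apply] at this
  rw [← this]
  congr 1 with x
  simp

lemma integral_ofReal_mul_im (f : L2) (θ : 𝓢(ℝ, ℂ)) :
    (∫ x, (f x : ℂ) * θ x).im = ∫ x, f x * schwartzIm θ x := by
  have := Complex.imCLM.integral_comp_comm
    (integrable_mul_of_L2 (memLp_ofReal f) (θ.memLp 2 volume))
  simp only [Complex.imCLM_apply] at this
  rw [← this]
  congr 1 with x
  simp

/-- The multiplication formula for the `L²` Fourier transform. -/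
lemma integral_fourier_mul (F : CL2) (θ : 𝓢(ℝ, ℂ)) :
    ∫ ξ, (𝓕 F : CL2) ξ * θ ξ = ∫ x, F x * 𝓕 θ x := by
  have h := congrArg (fun T => T θ) (Lp.fourier_toTemperedDistribution_eq F)
  simp only [TemperedDistribution.fourier_apply, Lp.toTemperedDistribution_apply,
    smul_eq_mul] at h
  simp only [mul_comm ((𝓕 F : CL2) _), mul_comm (F _)]
  exact h.symm

lemma integral_fhat_mul (f : L2) (θ : 𝓢(ℝ, ℂ)) :
    ∫ ξ, fhat f ξ * θ ξ = ∫ x, (f x : ℂ) * 𝓕 θ x := by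
  rw [fhat_apply, integral_fourier_mul]
  apply integral_congr_ae
  filter_upwards [toComplex_coeFn f] with x hx
  rw [hx]

/-- The Schwartz function `ξ ↦ 2πiξ θ(ξ)`. -/
def mulFreq (θ : 𝓢(ℝ, ℂ)) : 𝓢(ℝ, ℂ) :=
  SchwartzMap.smulLeftCLM ℂ (fun ξ : ℝ => 2 * (Real.pi : ℂ) * Complex.I * (ξ : ℂ)) θ

lemma hasTemperateGrowth_freq :
    (fun ξ : ℝ => 2 * (Real.pi : ℂ) * Complex.I * (ξ : ℂ)).HasTemperateGrowth := by
  have := Function.RCLike.hasTemperateGrowth_ofReal (𝕜 := ℂ)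
  have h2 := Function.HasTemperateGrowth.const (E := ℝ) (2 * (Real.pi : ℂ) * Complex.I)
  exact h2.mul this

@[simp] lemma mulFreq_apply (θ : 𝓢(ℝ, ℂ)) (ξ : ℝ) :
    mulFreq θ ξ = 2 * (Real.pi : ℂ) * Complex.I * (ξ : ℂ) * θ ξ := by
  rw [mulFreq, SchwartzMap.smulLeftCLM_apply_apply hasTemperateGrowth_freq, smul_eq_mul]

lemma deriv_fourier_schwartz (θ : 𝓢(ℝ, ℂ)) (x : ℝ) :
    deriv (𝓕 θ : 𝓢(ℝ, ℂ)) x = - (𝓕 (mulFreq θ) : 𝓢(ℝ, ℂ)) x := by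
  have h := congrArg (fun f : 𝓢(ℝ, ℂ) => f x) (SchwartzMap.lineDerivOp_fourier_eq θ (1 : ℝ))
  simp only [SchwartzMap.lineDerivOp_apply] at h
  have h1 : lineDeriv ℝ (𝓕 θ : 𝓢(ℝ, ℂ)) x 1 = deriv (𝓕 θ : 𝓢(ℝ, ℂ)) x := by
    rw [(SchwartzMap.differentiableAt _).lineDeriv_eq_fderiv]
    simp
  rw [h1] at h
  rw [h]
  have h2 : (-(2 * Real.pi * Complex.I) • SchwartzMap.smulLeftCLM ℂ (inner ℝ · (1 : ℝ)) θ)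
      = - mulFreq θ := by
    ext ξ
    have : (fun x : ℝ => x).HasTemperateGrowth := by fun_prop
    simp [SchwartzMap.smulLeftCLM_apply_apply this, mul_assoc]
  rw [h2]
  have := FourierTransform.fourier_neg (F := 𝓢(ℝ, ℂ)) (mulFreq θ)
  rw [this]; rfl

lemma HasWeakDeriv.integral_complex {f g : L2} (h : HasWeakDeriv f g) (θ : 𝓢(ℝ, ℂ)) :
    ∫ x, (f x : ℂ) * deriv θ x = - ∫ x, (g x : ℂ) * θ x := by
  have e : ∀ x, deriv θ x = SchwartzMap.derivCLM ℝ ℂ θ x := fun x => rfl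
  have hre : schwartzRe (SchwartzMap.derivCLM ℝ ℂ θ) = deriv (schwartzRe θ) := by
    ext x; rw [deriv_schwartzRe]; rfl
  have him : schwartzIm (SchwartzMap.derivCLM ℝ ℂ θ) = deriv (schwartzIm θ) := by
    ext x; rw [deriv_schwartzIm]; rfl
  simp only [e]
  apply Complex.ext
  · rw [Complex.neg_re, integral_ofReal_mul_re, integral_ofReal_mul_re, ← h (schwartzRe θ), hre]
  · rw [Complex.neg_im, integral_ofReal_mul_im, integral_ofReal_mul_im, ← h (schwartzIm θ), him]

/-- Locally integrable functions are determined by their integrals against Schwartz functions. -/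
lemma ae_eq_of_integral_schwartz {F G : ℝ → ℂ} (hF : LocallyIntegrable F)
    (hG : LocallyIntegrable G)
    (h : ∀ θ : 𝓢(ℝ, ℂ), ∫ ξ, F ξ * θ ξ = ∫ ξ, G ξ * θ ξ) : F =ᵐ[volume] G := by
  apply ae_eq_of_integral_contDiff_smul_eq hF hG
  intro g hg hc
  have hg' : ContDiff ℝ (⊤ : ℕ∞) (fun x => (g x : ℂ)) :=
    Complex.ofRealCLM.contDiff.comp hg
  have hc' : HasCompactSupport (fun x => (g x : ℂ)) :=
    hc.comp_left (g := fun y : ℝ => (y : ℂ)) (by simp)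
  have := h (hc'.toSchwartzMap hg')
  simpa [mul_comm] using this

lemma locallyIntegrable_mul_continuous (F : CL2) {m : ℝ → ℂ} (hm : Continuous m) :
    LocallyIntegrable (fun ξ => F ξ * m ξ) := by
  have hF : LocallyIntegrable (F : ℝ → ℂ) := (Lp.memLp F).locallyIntegrable (by norm_num)
  rw [← locallyIntegrableOn_univ] at hF ⊢
  exact hF.mul_continuousOn hm.continuousOn isOpen_univ.isLocallyClosed

lemma continuous_freq : Continuous fun ξ : ℝ => 2 * (Real.pi : ℂ) * Complex.I * (ξ : ℂ) := by
  fun_prop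

/-- Weak differentiation is multiplication by `2πiξ` on the Fourier side. -/
lemma HasWeakDeriv.fhat_eq {f g : L2} (h : HasWeakDeriv f g) :
    (fhat g : ℝ → ℂ) =ᵐ[volume] fun ξ => fhat f ξ * (2 * (Real.pi : ℂ) * Complex.I * (ξ : ℂ)) := by
  apply ae_eq_of_integral_schwartz
  · exact (Lp.memLp _).locallyIntegrable (by norm_num)
  · exact locallyIntegrable_mul_continuous _ continuous_freq
  intro θ
  have h1 := h.integral_complex (𝓕 θ)
  simp only [deriv_fourier_schwartz, mul_neg, integral_neg, neg_inj] at h1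
  rw [integral_fhat_mul, ← h1, ← integral_fhat_mul]
  congr 1 with ξ
  rw [mulFreq_apply]; ring

/-- The integral of the real part of `G` against a real Schwartz function. -/
lemma integral_coeFn_mul_complex {g : L2} {G : CL2}
    (hG : ∀ᵐ x, g x = (G x).re) (φ : 𝓢(ℝ, ℝ)) :
    ∫ x, g x * φ x = (∫ x, G x * (φ x : ℂ)).re := by
  have hφ : MemLp (fun x => (φ x : ℂ)) 2 volume := (φ.memLp 2 volume).ofReal
  have := Complex.reCLM.integral_comp_comm (integrable_mul_of_L2 (Lp.memLp G) hφ)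
  simp only [Complex.reCLM_apply] at this
  rw [← this]
  apply integral_congr_ae
  filter_upwards [hG] with x hx
  simp [hx]

/-- The complexification of a real Schwartz function. -/
def schwartzOfReal : 𝓢(ℝ, ℝ) →L[ℝ] 𝓢(ℝ, ℂ) := SchwartzMap.postcompCLM (𝕜 := ℝ) Complex.ofRealCLM

@[simp] lemma schwartzOfReal_apply (φ : 𝓢(ℝ, ℝ)) (x : ℝ) : schwartzOfReal φ x = (φ x : ℂ) := rfl

lemma deriv_schwartzOfReal (φ : 𝓢(ℝ, ℝ)) (x : ℝ) :
    deriv (schwartzOfReal φ) x = ((deriv φ x : ℝ) : ℂ) := by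
  have h := Complex.ofRealCLM.hasFDerivAt.comp_hasDerivAt x (φ.hasDerivAt x)
  exact h.deriv

/-- If `2πiξ f̂` is square integrable, then `f` has a weak derivative in `L²`. -/
lemma exists_hasWeakDeriv {f : L2}
    (hf : MemLp (fun ξ => fhat f ξ * (2 * (Real.pi : ℂ) * Complex.I * (ξ : ℂ))) 2 volume) :
    ∃ g, HasWeakDeriv f g := by
  set H : CL2 := hf.toLp with hH
  set G : CL2 := 𝓕⁻ H with hG
  have hFG : (𝓕 G : CL2) = H := FourierTransform.fourier_fourierInv_eq H
  refine ⟨Complex.reCLM.compLp G, fun φ => ?_⟩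
  rw [integral_coeFn_mul_complex (G := G) (Complex.reCLM.coeFn_compLp G)]
  -- the test function is written as a Fourier transform
  set θ : 𝓢(ℝ, ℂ) := 𝓕⁻ (schwartzOfReal φ) with hθ
  have hθφ : 𝓕 θ = schwartzOfReal φ := FourierTransform.fourier_fourierInv_eq _
  have h1 : ∫ x, G x * (φ x : ℂ) = ∫ ξ, H ξ * θ ξ := by
    rw [← hFG, integral_fourier_mul, hθφ]; rfl
  have h2 : ∫ ξ, H ξ * θ ξ = ∫ ξ, fhat f ξ * mulFreq θ ξ := by
    apply integral_congr_ae
    filter_upwards [hf.coeFn_toLp] with ξ hξ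
    rw [hH, hξ, mulFreq_apply]; ring
  have h3 : ∀ x, (𝓕 (mulFreq θ) : 𝓢(ℝ, ℂ)) x = - ((deriv φ x : ℝ) : ℂ) := by
    intro x
    rw [← deriv_schwartzOfReal, ← hθφ, deriv_fourier_schwartz, neg_neg]
  rw [h1, h2, integral_fhat_mul]
  simp only [h3, mul_neg, integral_neg, Complex.neg_re, neg_neg]
  have (x : ℝ) : (f x : ℂ) * ((deriv φ x : ℝ) : ℂ) = ((f x * deriv φ x : ℝ) : ℂ) := by
    push_cast; rfl
  simp only [this]
  rw [integral_complex_ofReal, Complex.ofReal_re]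

lemma memLp_bdd_mul {𝕜 : Type*} [RCLike 𝕜] {m : ℝ → 𝕜} (hm : Measurable m) {C : ℝ}
    (hC : ∀ x, ‖m x‖ ≤ C) (F : Lp 𝕜 2 (volume : Measure ℝ)) :
    MemLp (fun x => m x * F x) 2 volume :=
  (Lp.memLp F).of_le_mul (c := C)
    (hm.aestronglyMeasurable.mul (Lp.aestronglyMeasurable F))
    (Eventually.of_forall fun x => by
      rw [norm_mul]; exact mul_le_mul_of_nonneg_right (hC x) (norm_nonneg _))

/-- Multiplication by a bounded measurable function `m`, as an operator on `L²`; the bound `C` of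
`‖m‖` is an explicit argument. -/
def mulOp {𝕜 : Type*} [RCLike 𝕜] (m : ℝ → 𝕜) (hm : Measurable m) (C : ℝ) (hC : ∀ x, ‖m x‖ ≤ C) :
    Lp 𝕜 2 (volume : Measure ℝ) →L[𝕜] Lp 𝕜 2 (volume : Measure ℝ) :=
  LinearMap.mkContinuous
    { toFun := fun F => (memLp_bdd_mul hm hC F).toLp
      map_add' := fun F G => by
        rw [← MemLp.toLp_add]
        apply MemLp.toLp_congr
        filter_upwards [Lp.coeFn_add F G] with x hx
        simp only [Pi.add_apply] at hx ⊢
        rw [hx, mul_add]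
      map_smul' := fun c F => by
        rw [RingHom.id_apply, ← MemLp.toLp_const_smul]
        apply MemLp.toLp_congr
        filter_upwards [Lp.coeFn_smul c F] with x hx
        simp only [hx, Pi.smul_apply, smul_eq_mul]
        ring }
    C (fun F => by
      apply Lp.norm_le_mul_norm_of_ae_le_mul
      filter_upwards [(memLp_bdd_mul hm hC F).coeFn_toLp] with x hx
      simp only [LinearMap.coe_mk, AddHom.coe_mk]
      rw [hx, norm_mul]; exact mul_le_mul_of_nonneg_right (hC x) (norm_nonneg _))

lemma mulOp_coeFn {𝕜 : Type*} [RCLike 𝕜] {m : ℝ → 𝕜} (hm : Measurable m) {C : ℝ}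
    (hC : ∀ x, ‖m x‖ ≤ C) (F : Lp 𝕜 2 (volume : Measure ℝ)) :
    mulOp m hm C hC F =ᵐ[volume] fun x => m x * F x :=
  (memLp_bdd_mul hm hC F).coeFn_toLp

lemma ofReal_norm_sq {𝕜 : Type*} [RCLike 𝕜] (F : Lp 𝕜 2 (volume : Measure ℝ)) :
    ENNReal.ofReal (‖F‖ ^ 2) = ∫⁻ x, ‖F x‖ₑ ^ 2 := by
  rw [Lp.norm_def, ENNReal.ofReal_pow ENNReal.toReal_nonneg,
    ENNReal.ofReal_toReal (Lp.eLpNorm_ne_top F),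
    eLpNorm_eq_lintegral_rpow_enorm_toReal (by norm_num) (by norm_num)]
  simp only [ENNReal.toReal_ofNat, ENNReal.rpow_ofNat, one_div]
  rw [← ENNReal.rpow_natCast, ← ENNReal.rpow_mul]
  norm_num

lemma norm_sq_eq_integral {𝕜 : Type*} [RCLike 𝕜] (F : Lp 𝕜 2 (volume : Measure ℝ)) :
    ‖F‖ ^ 2 = ∫ x, ‖F x‖ ^ 2 := by
  rw [integral_eq_lintegral_of_nonneg_ae (f := fun x => ‖F x‖ ^ 2)
    (Eventually.of_forall fun x => by positivity) ((Lp.aestronglyMeasurable F).norm.pow 2)]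
  simp_rw [ENNReal.ofReal_pow (norm_nonneg _), ofReal_norm]
  rw [← ofReal_norm_sq, ENNReal.toReal_ofReal (by positivity)]

/-! ### Weak derivatives and Sobolev norms -/

lemma HasWeakDeriv.unique {f g g' : L2} (h : HasWeakDeriv f g) (h' : HasWeakDeriv f g') :
    g = g' := by
  have h1 : fhat g = fhat g' := Lp.ext (h.fhat_eq.trans h'.fhat_eq.symm)
  have h2 : ‖g - g'‖ = 0 := by rw [← norm_fhat, map_sub, h1, sub_self, norm_zero]
  exact sub_eq_zero.mp (norm_eq_zero.mp h2)

lemma HasWeakDeriv.weakDeriv_eq {f g : L2} (h : HasWeakDeriv f g) : weakDeriv f = g := by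
  have hex : ∃ g : L2, HasWeakDeriv f g := ⟨g, h⟩
  rw [weakDeriv, dif_pos hex]
  exact hex.choose_spec.unique h

lemma integrable_coeFn_mul (f : L2) {m : ℝ → ℝ} (hm : MemLp m 2 volume) :
    Integrable fun x => f x * m x := (Lp.memLp f).integrable_mul hm

lemma memLp_deriv (φ : 𝓢(ℝ, ℝ)) : MemLp (deriv φ) 2 volume :=
  (SchwartzMap.derivCLM ℝ ℝ φ).memLp 2 volume

lemma HasWeakDeriv.add {f f' g g' : L2} (hf : HasWeakDeriv f f') (hg : HasWeakDeriv g g') :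
    HasWeakDeriv (f + g) (f' + g') := by
  intro φ
  have e1 : ∫ x, (f + g) x * deriv φ x = (∫ x, f x * deriv φ x) + ∫ x, g x * deriv φ x := by
    rw [← integral_add (integrable_coeFn_mul f (memLp_deriv φ))
      (integrable_coeFn_mul g (memLp_deriv φ))]
    apply integral_congr_ae
    filter_upwards [Lp.coeFn_add f g] with x hx
    rw [hx, Pi.add_apply]; ring
  have e2 : ∫ x, (f' + g') x * φ x = (∫ x, f' x * φ x) + ∫ x, g' x * φ x := by
    rw [← integral_add (integrable_coeFn_mul f' (φ.memLp 2 volume))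
      (integrable_coeFn_mul g' (φ.memLp 2 volume))]
    apply integral_congr_ae
    filter_upwards [Lp.coeFn_add f' g'] with x hx
    rw [hx, Pi.add_apply]; ring
  rw [e1, e2, hf φ, hg φ]; ring

lemma HasWeakDeriv.const_smul {f f' : L2} (c : ℝ) (hf : HasWeakDeriv f f') :
    HasWeakDeriv (c • f) (c • f') := by
  intro φ
  have e (f : L2) (m : ℝ → ℝ) : ∫ x, (c • f) x * m x = c * ∫ x, f x * m x := by
    rw [← integral_const_mul]
    apply integral_congr_ae
    filter_upwards [Lp.coeFn_smul c f] with x hx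
    rw [hx, Pi.smul_apply, smul_eq_mul]; ring
  rw [e, e, hf φ]; ring

lemma HasWeakDeriv.sub {f f' g g' : L2} (hf : HasWeakDeriv f f') (hg : HasWeakDeriv g g') :
    HasWeakDeriv (f - g) (f' - g') := by
  have := hf.add (hg.const_smul (-1))
  simpa [sub_eq_add_neg] using this

lemma norm_freq (ξ : ℝ) :
    ‖2 * (Real.pi : ℂ) * Complex.I * (ξ : ℂ)‖ ^ 2 = (2 * Real.pi * ξ) ^ 2 := by
  simp only [norm_mul, Complex.norm_ofNat, Complex.norm_real, Complex.norm_I, mul_one, mul_pow,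
    Real.norm_eq_abs, sq_abs]

lemma enorm_sq_eq_ofReal (z : ℂ) : ‖z‖ₑ ^ 2 = ENNReal.ofReal (‖z‖ ^ 2) := by
  rw [ENNReal.ofReal_pow (norm_nonneg _), ofReal_norm]

lemma eSobolevSq_eq (s : ℝ) (f : L2) :
    eSobolevSq s f = ∫⁻ ξ : ℝ, ENNReal.ofReal ((1 + (2 * Real.pi * ξ) ^ 2) ^ s) *
      ‖fhat f ξ‖ₑ ^ 2 := rfl

lemma measurable_weight (s : ℝ) :
    Measurable fun ξ : ℝ => (1 + (2 * Real.pi * ξ) ^ 2) ^ s := by fun_prop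

lemma HasWeakDeriv.eSobolevSq_one {f g : L2} (h : HasWeakDeriv f g) :
    eSobolevSq 1 f = ENNReal.ofReal (‖f‖ ^ 2 + ‖g‖ ^ 2) := by
  rw [ENNReal.ofReal_add (by positivity) (by positivity), ← norm_fhat f, ← norm_fhat g,
    ofReal_norm_sq, ofReal_norm_sq, eSobolevSq_eq,
    ← lintegral_add_left' ((Lp.aestronglyMeasurable _).enorm.pow_const 2)]
  apply lintegral_congr_ae
  filter_upwards [h.fhat_eq] with ξ hξ
  rw [hξ, enorm_sq_eq_ofReal, enorm_sq_eq_ofReal, norm_mul, mul_pow _ ‖_‖, norm_freq,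
    ← ENNReal.ofReal_add (by positivity) (by positivity), ← ENNReal.ofReal_mul (by positivity),
    Real.rpow_one]
  congr 1; ring

lemma HasWeakDeriv.eSobolevSq_two {f g : L2} (h : HasWeakDeriv f g) :
    eSobolevSq 2 f = eSobolevSq 1 f + eSobolevSq 1 g := by
  rw [eSobolevSq_eq, eSobolevSq_eq, eSobolevSq_eq, ← lintegral_add_left']
  · apply lintegral_congr_ae
    filter_upwards [h.fhat_eq] with ξ hξ
    rw [hξ, enorm_sq_eq_ofReal, enorm_sq_eq_ofReal, norm_mul, mul_pow _ ‖_‖, norm_freq,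
      ← ENNReal.ofReal_mul (by positivity), ← ENNReal.ofReal_mul (by positivity),
      ← ENNReal.ofReal_mul (by positivity),
      ← ENNReal.ofReal_add (by positivity) (by positivity), Real.rpow_one, Real.rpow_two]
    congr 1; ring
  · exact (measurable_weight 1).ennreal_ofReal.aemeasurable.mul
      ((Lp.aestronglyMeasurable _).enorm.pow_const 2)

lemma exists_hasWeakDeriv_of_lt_top {f : L2} (hf : eSobolevSq 1 f < ∞) :
    ∃ g, HasWeakDeriv f g := by
  apply exists_hasWeakDeriv
  refine ⟨(Lp.aestronglyMeasurable _).mul continuous_freq.aestronglyMeasurable, ?_⟩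
  rw [eLpNorm_lt_top_iff_lintegral_rpow_enorm_lt_top (by norm_num) (by norm_num)]
  refine lt_of_le_of_lt (lintegral_mono fun ξ => ?_) (eSobolevSq_eq 1 f ▸ hf)
  simp only [ENNReal.toReal_ofNat, ENNReal.rpow_ofNat]
  rw [enorm_sq_eq_ofReal, enorm_sq_eq_ofReal, norm_mul, mul_pow _ ‖_‖, norm_freq,
    ← ENNReal.ofReal_mul (by positivity), Real.rpow_one]
  apply ENNReal.ofReal_le_ofReal
  nlinarith [sq_nonneg ‖fhat f ξ‖]

lemma hasWeakDeriv_weakDeriv {f : L2} (hf : eSobolevSq 1 f < ∞) :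
    HasWeakDeriv f (weakDeriv f) := by
  obtain ⟨g, hg⟩ := exists_hasWeakDeriv_of_lt_top hf
  rwa [hg.weakDeriv_eq]

lemma HasWeakDeriv.eSobolevSq_one_lt_top {f g : L2} (h : HasWeakDeriv f g) :
    eSobolevSq 1 f < ∞ := by rw [h.eSobolevSq_one]; exact ENNReal.ofReal_lt_top

lemma eSobolevSq_one_le_two (f : L2) : eSobolevSq 1 f ≤ eSobolevSq 2 f := by
  apply lintegral_mono fun ξ => ?_
  gcongr
  · nlinarith [sq_nonneg (2 * Real.pi * ξ)]
  · norm_num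

lemma exists_hasWeakDeriv_two {f : L2} (hf : eSobolevSq 2 f < ∞) :
    ∃ g k, HasWeakDeriv f g ∧ HasWeakDeriv g k := by
  obtain ⟨g, hg⟩ := exists_hasWeakDeriv_of_lt_top ((eSobolevSq_one_le_two f).trans_lt hf)
  rw [hg.eSobolevSq_two] at hf
  obtain ⟨k, hk⟩ := exists_hasWeakDeriv_of_lt_top (le_add_self.trans_lt hf)
  exact ⟨g, k, hg, hk⟩

lemma sobolevNorm_nonneg (s : ℝ) (f : L2) : 0 ≤ sobolevNorm s f := Real.sqrt_nonneg _

lemma sobolevNorm_sq (s : ℝ) (f : L2) : sobolevNorm s f ^ 2 = (eSobolevSq s f).toReal :=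
  Real.sq_sqrt ENNReal.toReal_nonneg

lemma HasWeakDeriv.sobolevNorm_one_sq {f g : L2} (h : HasWeakDeriv f g) :
    sobolevNorm 1 f ^ 2 = ‖f‖ ^ 2 + ‖g‖ ^ 2 := by
  rw [sobolevNorm_sq, h.eSobolevSq_one, ENNReal.toReal_ofReal (by positivity)]

lemma HasWeakDeriv.sobolevNorm_two_sq {f g k : L2} (h : HasWeakDeriv f g)
    (h' : HasWeakDeriv g k) :
    sobolevNorm 2 f ^ 2 = ‖f‖ ^ 2 + 2 * ‖g‖ ^ 2 + ‖k‖ ^ 2 := by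
  rw [sobolevNorm_sq, h.eSobolevSq_two, h.eSobolevSq_one, h'.eSobolevSq_one,
    ← ENNReal.ofReal_add (by positivity) (by positivity), ENNReal.toReal_ofReal (by positivity)]
  ring

lemma eSobolevSq_sub_le (s : ℝ) (f g : L2) :
    eSobolevSq s (f - g) ≤ 2 * (eSobolevSq s f + eSobolevSq s g) := by
  rw [eSobolevSq_eq, eSobolevSq_eq, eSobolevSq_eq, ← lintegral_add_left',
    ← lintegral_const_mul' _ _ (by norm_num)]
  · apply lintegral_mono_ae
    have h := Lp.coeFn_sub (fhat f) (fhat g)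
    rw [← map_sub] at h
    filter_upwards [h] with ξ hξ
    rw [hξ, Pi.sub_apply, ← mul_add, mul_left_comm]
    gcongr
    rw [enorm_sq_eq_ofReal, enorm_sq_eq_ofReal, enorm_sq_eq_ofReal,
      ← ENNReal.ofReal_add (by positivity) (by positivity)]
    have h2 : (2 : ℝ≥0∞) = ENNReal.ofReal 2 := by norm_num
    refine le_trans ?_ (mul_le_mul_left (h2.symm.le) _)
    rw [← ENNReal.ofReal_mul (by positivity)]
    apply ENNReal.ofReal_le_ofReal
    have := norm_sub_le (fhat f ξ) (fhat g ξ)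
    nlinarith [norm_nonneg (fhat f ξ - fhat g ξ), sq_nonneg (‖fhat f ξ‖ - ‖fhat g ξ‖)]
  · exact (measurable_weight s).ennreal_ofReal.aemeasurable.mul
      ((Lp.aestronglyMeasurable _).enorm.pow_const 2)

/-- The Sobolev norm is lower semicontinuous on `L²(ℝ)`, being a supremum of continuous
truncations. -/
lemma lowerSemicontinuous_eSobolevSq (s : ℝ) : LowerSemicontinuous (eSobolevSq s) := by
  set m : ℕ → ℝ → ℂ := fun n ξ =>
    ((Real.sqrt (min ((1 + (2 * Real.pi * ξ) ^ 2) ^ s) n) : ℝ) : ℂ) with hm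
  have hmeas : ∀ n, Measurable (m n) := fun n =>
    Complex.measurable_ofReal.comp ((measurable_weight s).min measurable_const).sqrt
  have hbd : ∀ n ξ, ‖m n ξ‖ ≤ Real.sqrt n := fun n ξ => by
    rw [hm, Complex.norm_real, Real.norm_of_nonneg (Real.sqrt_nonneg _)]
    exact Real.sqrt_le_sqrt (min_le_right _ _)
  have key : eSobolevSq s = fun f => ⨆ n : ℕ,
      ENNReal.ofReal (‖mulOp (m n) (hmeas n) _ (hbd n) (fhat f)‖ ^ 2) := by
    funext f
    have h1 : ∀ n : ℕ, ENNReal.ofReal (‖mulOp (m n) (hmeas n) _ (hbd n) (fhat f)‖ ^ 2) =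
        ∫⁻ ξ, ENNReal.ofReal (min ((1 + (2 * Real.pi * ξ) ^ 2) ^ s) n) * ‖fhat f ξ‖ₑ ^ 2 := by
      intro n
      rw [ofReal_norm_sq]
      apply lintegral_congr_ae
      filter_upwards [mulOp_coeFn (hmeas n) (hbd n) (fhat f)] with ξ hξ
      have hnn : 0 ≤ min ((1 + (2 * Real.pi * ξ) ^ 2) ^ s) (n : ℝ) :=
        le_min (by positivity) (by positivity)
      rw [hξ, enorm_sq_eq_ofReal, enorm_sq_eq_ofReal, norm_mul, mul_pow, hm, Complex.norm_real,
        Real.norm_of_nonneg (Real.sqrt_nonneg _), Real.sq_sqrt hnn, ENNReal.ofReal_mul hnn]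
    simp_rw [h1]
    have hmt : ∀ n : ℕ, AEMeasurable (fun ξ : ℝ =>
        ENNReal.ofReal (min ((1 + (2 * Real.pi * ξ) ^ 2) ^ s) n) * ‖fhat f ξ‖ₑ ^ 2) volume := fun n =>
      ((measurable_weight s).min measurable_const).ennreal_ofReal.aemeasurable.mul
        ((Lp.aestronglyMeasurable _).enorm.pow_const 2)
    rw [← lintegral_iSup' hmt]
    · rw [eSobolevSq_eq]
      congr 1 with ξ
      rw [← ENNReal.iSup_mul]
      congr 1
      apply le_antisymm
      · obtain ⟨n, hn⟩ := exists_nat_ge ((1 + (2 * Real.pi * ξ) ^ 2) ^ s)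
        refine le_trans ?_ (le_iSup _ n)
        rw [min_eq_left hn]
      · exact iSup_le fun n => ENNReal.ofReal_le_ofReal (min_le_left _ _)
    · refine Eventually.of_forall fun ξ i j hij => ?_
      dsimp only
      gcongr
  rw [key]
  apply lowerSemicontinuous_iSup fun n => ?_
  apply Continuous.lowerSemicontinuous
  exact ENNReal.continuous_ofReal.comp (by fun_prop)

/-- Continuity in `L²` is enough for the Sobolev norms along a path to be measurable in time. -/
lemma measurable_eSobolevSq_comp (s : ℝ) {w : ℝ → L2} (hw : Continuous w) :
    Measurable fun t => eSobolevSq s (w t) :=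
  ((lowerSemicontinuous_eSobolevSq s).comp hw).measurable

/-! ### Density of Schwartz functions in `H¹(ℝ)` -/

/-- A real Schwartz function as an element of `L²(ℝ)`. -/
abbrev schwartzL2 (φ : 𝓢(ℝ, ℝ)) : L2 := φ.toLp 2 volume

lemma norm_sub_schwartzRe_le (f : L2) (Φ : 𝓢(ℝ, ℂ)) :
    ‖f - schwartzL2 (schwartzRe Φ)‖ ≤ ‖toComplex f - Φ.toLp 2 volume‖ := by
  apply Lp.norm_le_norm_of_ae_le
  filter_upwards [Lp.coeFn_sub f (schwartzL2 (schwartzRe Φ)),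
    Lp.coeFn_sub (toComplex f) (Φ.toLp 2 volume), (schwartzRe Φ).coeFn_toLp 2 volume,
    Φ.coeFn_toLp 2 volume, toComplex_coeFn f] with x h1 h2 h3 h4 h5
  rw [h1, h2, Pi.sub_apply, Pi.sub_apply, h3, h4, h5, schwartzRe_apply]
  have := Complex.abs_re_le_norm ((f x : ℂ) - Φ x)
  simpa using this

lemma fourier_derivCLM (Φ : 𝓢(ℝ, ℂ)) :
    𝓕 (SchwartzMap.derivCLM ℝ ℂ Φ) = mulFreq (𝓕 Φ) := by
  have h := SchwartzMap.fourier_lineDerivOp_eq Φ (1 : ℝ)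
  have h1 : LineDeriv.lineDerivOp (1 : ℝ) Φ = SchwartzMap.derivCLM ℝ ℂ Φ := by
    ext x
    rw [SchwartzMap.lineDerivOp_apply, (SchwartzMap.differentiableAt _).lineDeriv_eq_fderiv]
    simp
  rw [← h1, h]
  ext ξ
  have : (fun x : ℝ => x).HasTemperateGrowth := by fun_prop
  simp [SchwartzMap.smulLeftCLM_apply_apply this, mul_assoc]

lemma norm_toComplex_sub_schwartz (f : L2) (Φ : 𝓢(ℝ, ℂ)) :
    ‖toComplex f - Φ.toLp 2 volume‖ = ‖fhat f - (𝓕 Φ : 𝓢(ℝ, ℂ)).toLp 2 volume‖ := by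
  rw [← SchwartzMap.toLp_fourier_eq, fhat_apply, ← Lp.norm_fourier_eq]
  congr 1
  exact map_sub (Lp.fourierTransformₗᵢ ℝ ℂ) _ _

lemma deriv_schwartzRe_eq (Φ : 𝓢(ℝ, ℂ)) :
    SchwartzMap.derivCLM ℝ ℝ (schwartzRe Φ) = schwartzRe (SchwartzMap.derivCLM ℝ ℂ Φ) := by
  ext x
  exact deriv_schwartzRe Φ x

/-- Schwartz functions are dense in `H¹(ℝ)`. On the Fourier side `(1 + ξ²)^(1/2) f̂` is approximated
by a Schwartz function in `L²`, which is then divided by the weight. -/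
lemma HasWeakDeriv.exists_schwartz_near {f g : L2} (h : HasWeakDeriv f g) {ε : ℝ} (hε : 0 < ε) :
    ∃ φ : 𝓢(ℝ, ℝ), ‖f - schwartzL2 φ‖ < ε ∧
      ‖g - schwartzL2 (SchwartzMap.derivCLM ℝ ℝ φ)‖ < ε := by
  have hsq : ∀ ξ : ℝ, 0 < 1 + ‖ξ‖ ^ 2 := fun ξ => by positivity
  have hK : MemLp (fun ξ : ℝ => ((1 + ‖ξ‖ ^ 2) ^ (1 / 2 : ℝ)) • fhat f ξ) 2 volume := by
    have hm : Measurable fun ξ : ℝ => (1 + ‖ξ‖ ^ 2) ^ (1 / 2 : ℝ) := by fun_prop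
    refine MemLp.of_le (g := fun ξ => ‖fhat f ξ‖ + ‖fhat g ξ‖)
      ((Lp.memLp _).norm.add (Lp.memLp _).norm)
      (hm.aestronglyMeasurable.smul (Lp.aestronglyMeasurable _)) ?_
    filter_upwards [h.fhat_eq] with ξ hξ
    have h0 : 0 ≤ (1 + ‖ξ‖ ^ 2) ^ (1 / 2 : ℝ) := (Real.rpow_pos_of_pos (hsq ξ) _).le
    rw [hξ, norm_smul, Real.norm_of_nonneg h0,
      Real.norm_of_nonneg (add_nonneg (norm_nonneg _) (norm_nonneg _)), norm_mul,
      ← Real.sqrt_eq_rpow]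
    have h1 : Real.sqrt (1 + ‖ξ‖ ^ 2) ≤ 1 + ‖2 * (Real.pi : ℂ) * Complex.I * (ξ : ℂ)‖ := by
      apply Real.sqrt_le_iff.mpr ⟨by positivity, ?_⟩
      have h2 := norm_freq ξ
      have h3 : ‖ξ‖ ^ 2 ≤ (2 * Real.pi * ξ) ^ 2 := by
        rw [Real.norm_eq_abs, sq_abs]
        have h4 : 1 ≤ (2 * Real.pi) ^ 2 := by nlinarith [Real.pi_gt_three]
        rw [mul_pow]
        nlinarith [sq_nonneg ξ]
      nlinarith [norm_nonneg (2 * (Real.pi : ℂ) * Complex.I * (ξ : ℂ))]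
    nlinarith [norm_nonneg (fhat f ξ)]
  obtain ⟨θ, hθ⟩ : ∃ θ : 𝓢(ℝ, ℂ), dist hK.toLp (SchwartzMap.toLpCLM ℂ ℂ 2 volume θ) < ε / 7 :=
    (SchwartzMap.denseRange_toLpCLM (E := ℝ) (F := ℂ) (p := 2) (μ := volume)
      (by norm_num)).exists_dist_lt hK.toLp (by positivity)
  rw [dist_eq_norm, SchwartzMap.toLpCLM_apply] at hθ
  set η : 𝓢(ℝ, ℂ) :=
    SchwartzMap.smulLeftCLM ℂ (fun ξ : ℝ => (1 + ‖ξ‖ ^ 2) ^ (-(1 / 2) : ℝ)) θ with hη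
  have hηa : ∀ ξ, η ξ = ((1 + ‖ξ‖ ^ 2) ^ (-(1 / 2) : ℝ)) • θ ξ := fun ξ =>
    SchwartzMap.smulLeftCLM_apply_apply (by fun_prop) θ ξ
  set Φ : 𝓢(ℝ, ℂ) := 𝓕⁻ η with hΦ
  have hFΦ : 𝓕 Φ = η := FourierTransform.fourier_fourierInv_eq _
  have hdiff : ∀ᵐ ξ, fhat f ξ - η ξ = ((1 + ‖ξ‖ ^ 2) ^ (-(1 / 2) : ℝ)) •
      (hK.toLp - θ.toLp 2 volume : CL2) ξ := by
    filter_upwards [Lp.coeFn_sub hK.toLp (θ.toLp 2 volume), hK.coeFn_toLp,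
      θ.coeFn_toLp 2 volume] with ξ h1 h2 h3
    rw [h1, Pi.sub_apply, h2, h3, hηa, smul_sub, smul_smul, ← Real.rpow_add (hsq ξ)]
    norm_num
  refine ⟨schwartzRe Φ, ?_, ?_⟩
  · refine (norm_sub_schwartzRe_le f Φ).trans_lt ?_
    rw [norm_toComplex_sub_schwartz, hFΦ]
    refine lt_of_le_of_lt ?_ (hθ.trans_le (by linarith))
    apply Lp.norm_le_norm_of_ae_le
    filter_upwards [hdiff, Lp.coeFn_sub (fhat f) (η.toLp 2 volume), η.coeFn_toLp 2 volume]
      with ξ h1 h2 h3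
    rw [h2, Pi.sub_apply, h3, h1, norm_smul, Real.norm_of_nonneg (by positivity)]
    apply mul_le_of_le_one_left (norm_nonneg _)
    apply Real.rpow_le_one_of_one_le_of_nonpos (by nlinarith [sq_nonneg ‖ξ‖]) (by norm_num)
  · rw [deriv_schwartzRe_eq]
    refine (norm_sub_schwartzRe_le g _).trans_lt ?_
    rw [norm_toComplex_sub_schwartz, fourier_derivCLM, hFΦ]
    -- multiplication by `2πiξ (1 + ξ²)^(-1/2)` is bounded by `7`, because `2π < 7`
    refine lt_of_le_of_lt (b := 7 * ‖hK.toLp - θ.toLp 2 volume‖) ?_ (by linarith)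
    apply Lp.norm_le_mul_norm_of_ae_le_mul
    filter_upwards [hdiff, Lp.coeFn_sub (fhat g) ((mulFreq η).toLp 2 volume),
      (mulFreq η).coeFn_toLp 2 volume, h.fhat_eq] with ξ h1 h2 h3 h4
    rw [h2, Pi.sub_apply, h3, h4, mulFreq_apply, mul_comm (fhat f ξ), ← mul_sub, h1, norm_mul,
      norm_smul, ← mul_assoc, Real.norm_of_nonneg (by positivity)]
    apply mul_le_mul_of_nonneg_right _ (norm_nonneg _)
    rw [Real.rpow_neg (hsq ξ).le, ← div_eq_mul_inv, div_le_iff₀ (by have := hsq ξ; positivity),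
      ← Real.sqrt_eq_rpow]
    apply abs_le_of_sq_le_sq' _ (by positivity) |>.2
    have h5 : (2 * Real.pi) ^ 2 ≤ 7 ^ 2 := by nlinarith [Real.pi_lt_d2, Real.pi_gt_three]
    rw [norm_freq, mul_pow, mul_pow 7, Real.sq_sqrt (hsq ξ).le, Real.norm_eq_abs, sq_abs]
    nlinarith [sq_nonneg ξ]

/-- A closed relation on `L² × L²` that holds for all pairs `(φ, φ')` with `φ` Schwartz holds for
all pairs of an `H¹` function and its weak derivative. -/
lemma HasWeakDeriv.closed_induction {P : L2 → L2 → Prop}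
    (hP : IsClosed {p : L2 × L2 | P p.1 p.2})
    (hS : ∀ φ : 𝓢(ℝ, ℝ), P (schwartzL2 φ) (schwartzL2 (SchwartzMap.derivCLM ℝ ℝ φ)))
    {f g : L2} (h : HasWeakDeriv f g) : P f g := by
  have : (f, g) ∈ closure {p : L2 × L2 | P p.1 p.2} := by
    rw [Metric.mem_closure_iff]
    intro ε hε
    obtain ⟨φ, h1, h2⟩ := h.exists_schwartz_near hε
    refine ⟨(_, _), hS φ, ?_⟩
    rw [Prod.dist_eq, dist_eq_norm, dist_eq_norm]
    exact max_lt h1 h2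
  rwa [hP.closure_eq] at this

lemma norm_schwartzL2_sq (φ : 𝓢(ℝ, ℝ)) : ‖schwartzL2 φ‖ ^ 2 = ∫ x, φ x ^ 2 := by
  rw [norm_sq_eq_integral]
  apply integral_congr_ae
  filter_upwards [φ.coeFn_toLp 2 volume] with x hx
  rw [hx, Real.norm_eq_abs, sq_abs]

/-- The Sobolev inequality on the line, for Schwartz functions. -/
lemma schwartz_abs_le (φ : 𝓢(ℝ, ℝ)) (x : ℝ) :
    |φ x| ≤ ‖schwartzL2 φ‖ + ‖schwartzL2 (SchwartzMap.derivCLM ℝ ℝ φ)‖ := by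
  set φ' := SchwartzMap.derivCLM ℝ ℝ φ with hφ'
  have hi1 : Integrable fun y => φ y ^ 2 := (φ.memLp 2 volume).integrable_sq
  have hi2 : Integrable fun y => φ' y ^ 2 := (φ'.memLp 2 volume).integrable_sq
  have hi3 : Integrable fun y => 2 * φ y * φ' y := by
    have := (integrable_mul_of_L2 (φ.memLp 2 volume) (φ'.memLp 2 volume)).const_mul 2
    simpa [mul_assoc] using this
  have hd : ∀ y, HasDerivAt (fun y => φ y ^ 2) (2 * φ y * φ' y) y := fun y => by
    simpa using! (φ.hasDerivAt y).pow 2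
  have hlim : Tendsto (fun y => φ y ^ 2) atBot (𝓝 0) := by
    have h0 := (φ.tendsto_cocompact).mono_left (atBot_le_cocompact)
    simpa using! h0.pow 2
  have key := integral_Iic_of_hasDerivAt_of_tendsto' (a := x) (fun y _ => hd y)
    hi3.integrableOn hlim
  have h1 : φ x ^ 2 ≤ ‖schwartzL2 φ‖ ^ 2 + ‖schwartzL2 φ'‖ ^ 2 := by
    rw [norm_schwartzL2_sq, norm_schwartzL2_sq, ← integral_add hi1 hi2]
    calc φ x ^ 2 = ∫ y in Set.Iic x, 2 * φ y * φ' y := by rw [key]; ring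
      _ ≤ ∫ y in Set.Iic x, (φ y ^ 2 + φ' y ^ 2) :=
          setIntegral_mono hi3.integrableOn (hi1.add hi2).integrableOn
            fun y => two_mul_le_add_sq _ _
      _ ≤ ∫ y, (φ y ^ 2 + φ' y ^ 2) :=
          setIntegral_le_integral (hi1.add hi2) (Eventually.of_forall fun y => by positivity)
  apply abs_le_of_sq_le_sq _ (by positivity)
  nlinarith [norm_nonneg (schwartzL2 φ), norm_nonneg (schwartzL2 φ')]

/-- The Sobolev inequality on the line. -/
lemma HasWeakDeriv.abs_le {f g : L2} (h : HasWeakDeriv f g) : ∀ᵐ x, |f x| ≤ ‖f‖ + ‖g‖ := by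
  refine HasWeakDeriv.closed_induction (P := fun f g => ∀ᵐ x, |f x| ≤ ‖f‖ + ‖g‖) ?_ ?_ h
  · apply IsSeqClosed.isClosed
    intro p q hp hpq
    have h1 : Tendsto (fun n => (p n).1) atTop (𝓝 q.1) := (continuous_fst.tendsto q).comp hpq
    have h2 : Tendsto (fun n => ‖(p n).1‖ + ‖(p n).2‖) atTop (𝓝 (‖q.1‖ + ‖q.2‖)) :=
      ((by fun_prop : Continuous fun r : L2 × L2 => ‖r.1‖ + ‖r.2‖).tendsto q).comp hpq
    obtain ⟨ns, hns, hae⟩ := (tendstoInMeasure_of_tendsto_Lp h1).exists_seq_tendsto_ae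
    have h3 : ∀ᵐ x, ∀ n, |(p n).1 x| ≤ ‖(p n).1‖ + ‖(p n).2‖ := ae_all_iff.mpr hp
    filter_upwards [hae, h3] with x hx hx3
    exact le_of_tendsto_of_tendsto' hx.abs (h2.comp hns.tendsto_atTop) fun n => hx3 _
  · intro φ
    filter_upwards [φ.coeFn_toLp 2 volume] with x hx
    rw [hx]
    exact schwartz_abs_le φ x

lemma continuous_integral_mul {m : ℝ → ℝ} (hm : MemLp m 2 volume) :
    Continuous fun f : L2 => ∫ x, f x * m x := by
  have : (fun f : L2 => ∫ x, f x * m x) = fun f => inner ℝ hm.toLp f := by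
    funext f
    rw [L2.inner_def]
    apply integral_congr_ae
    filter_upwards [hm.coeFn_toLp] with x hx
    rw [hx]; rfl
  rw [this]; fun_prop

lemma schwartz_bdd (φ : 𝓢(ℝ, ℝ)) : ∃ C, ∀ x, ‖φ x‖ ≤ C :=
  ⟨_, fun x => SchwartzMap.norm_le_seminorm ℝ φ x⟩

lemma memLp_schwartz_mul (φ : 𝓢(ℝ, ℝ)) (f : L2) : MemLp (fun x => f x * φ x) 2 volume := by
  obtain ⟨C, hC⟩ := schwartz_bdd φ
  simpa [mul_comm] using memLp_bdd_mul φ.continuous.measurable hC f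

/-- The product rule for weak derivatives of `H¹` functions. By density the second factor may be
taken to be a Schwartz function, which is absorbed into the test function. -/
lemma HasWeakDeriv.mul {f f' g g' F F' : L2} (hf : HasWeakDeriv f f') (hg : HasWeakDeriv g g')
    (hF : ∀ᵐ x, F x = f x * g x) (hF' : ∀ᵐ x, F' x = f' x * g x + f x * g' x) :
    HasWeakDeriv F F' := by
  intro φ
  set dφ := SchwartzMap.derivCLM ℝ ℝ φ with hdφ
  have key : ∫ x, g x * (f x * dφ x) = - (∫ x, g x * (f' x * φ x)) - ∫ x, g' x * (f x * φ x) := by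
    refine HasWeakDeriv.closed_induction (P := fun g g' => ∫ x, g x * (f x * dφ x) =
      - (∫ x, g x * (f' x * φ x)) - ∫ x, g' x * (f x * φ x)) ?_ ?_ hg
    · have c1 := continuous_integral_mul (memLp_schwartz_mul dφ f)
      have c2 := continuous_integral_mul (memLp_schwartz_mul φ f')
      have c3 := continuous_integral_mul (memLp_schwartz_mul φ f)
      exact isClosed_eq (c1.comp continuous_fst)
        ((c2.comp continuous_fst).neg.sub (c3.comp continuous_snd))
    · intro γ
      set dγ := SchwartzMap.derivCLM ℝ ℝ γ with hdγ
      set γφ : 𝓢(ℝ, ℝ) := SchwartzMap.smulLeftCLM ℝ γ φ with hγφ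
      have ha : ∀ x, γφ x = γ x * φ x := fun x =>
        SchwartzMap.smulLeftCLM_apply_apply γ.hasTemperateGrowth φ x
      have hd : ∀ x, deriv γφ x = dγ x * φ x + γ x * dφ x := by
        intro x
        have : (γφ : ℝ → ℝ) = fun x => γ x * φ x := funext ha
        rw [this]
        exact ((γ.hasDerivAt x).mul (φ.hasDerivAt x)).deriv
      have h1 := hf γφ
      simp only [ha, hd] at h1
      have e1 : ∫ x, schwartzL2 γ x * (f x * dφ x) = ∫ x, γ x * (f x * dφ x) := by
        apply integral_congr_ae
        filter_upwards [γ.coeFn_toLp 2 volume] with x hx; rw [hx]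
      have e2 : ∫ x, schwartzL2 γ x * (f' x * φ x) = ∫ x, γ x * (f' x * φ x) := by
        apply integral_congr_ae
        filter_upwards [γ.coeFn_toLp 2 volume] with x hx; rw [hx]
      have e3 : ∫ x, schwartzL2 dγ x * (f x * φ x) = ∫ x, dγ x * (f x * φ x) := by
        apply integral_congr_ae
        filter_upwards [dγ.coeFn_toLp 2 volume] with x hx; rw [hx]
      rw [e1, e2, e3]
      have i1 : Integrable fun x => dγ x * (f x * φ x) :=
        (dγ.memLp 2 volume).integrable_mul (memLp_schwartz_mul φ f)
      have i2 : Integrable fun x => γ x * (f x * dφ x) :=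
        (γ.memLp 2 volume).integrable_mul (memLp_schwartz_mul dφ f)
      have e4 : ∫ x, f x * (dγ x * φ x + γ x * dφ x) =
          (∫ x, dγ x * (f x * φ x)) + ∫ x, γ x * (f x * dφ x) := by
        rw [← integral_add i1 i2]; congr 1 with x; ring
      have e5 : ∫ x, f' x * (γ x * φ x) = ∫ x, γ x * (f' x * φ x) := by congr 1 with x; ring
      linarith
  have e1 : ∫ x, F x * deriv φ x = ∫ x, g x * (f x * dφ x) := by
    apply integral_congr_ae
    filter_upwards [hF] with x hx
    rw [hx, hdφ, SchwartzMap.derivCLM_apply]; ring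
  have e2 : ∫ x, F' x * φ x = (∫ x, g x * (f' x * φ x)) + ∫ x, g' x * (f x * φ x) := by
    rw [← integral_add (integrable_coeFn_mul g (memLp_schwartz_mul φ f'))
      (integrable_coeFn_mul g' (memLp_schwartz_mul φ f))]
    apply integral_congr_ae
    filter_upwards [hF'] with x hx
    rw [hx]; ring
  rw [e1, e2, key]; ring

/-- The product rule for the product of a bounded `C¹` function with bounded derivative and an
`H¹` function. -/
lemma HasWeakDeriv.bdd_mul {f f' F F' : L2} (hf : HasWeakDeriv f f') {ψ ψ' : ℝ → ℝ} {A B : ℝ}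
    (hψ : ∀ x, HasDerivAt ψ (ψ' x) x) (hψ' : Measurable ψ') (hA : ∀ x, ‖ψ x‖ ≤ A)
    (hB : ∀ x, ‖ψ' x‖ ≤ B)
    (hF : ∀ᵐ x, F x = ψ x * f x) (hF' : ∀ᵐ x, F' x = ψ' x * f x + ψ x * f' x) :
    HasWeakDeriv F F' := by
  have hm : Measurable ψ := (continuous_iff_continuousAt.mpr fun x => (hψ x).continuousAt).measurable
  intro φ
  set dφ := SchwartzMap.derivCLM ℝ ℝ φ with hdφ
  have mem1 (η : 𝓢(ℝ, ℝ)) : MemLp (fun x => ψ x * η x) 2 volume :=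
    (η.memLp 2 volume).of_le_mul (c := A)
      (hm.aestronglyMeasurable.mul η.continuous.aestronglyMeasurable)
      (Eventually.of_forall fun x => by
        rw [norm_mul]; exact mul_le_mul_of_nonneg_right (hA x) (norm_nonneg _))
  have mem2 (η : 𝓢(ℝ, ℝ)) : MemLp (fun x => ψ' x * η x) 2 volume :=
    (η.memLp 2 volume).of_le_mul (c := B)
      (hψ'.aestronglyMeasurable.mul η.continuous.aestronglyMeasurable)
      (Eventually.of_forall fun x => by
        rw [norm_mul]; exact mul_le_mul_of_nonneg_right (hB x) (norm_nonneg _))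
  have key : ∫ x, f x * (ψ x * dφ x) = - (∫ x, f x * (ψ' x * φ x)) - ∫ x, f' x * (ψ x * φ x) := by
    refine HasWeakDeriv.closed_induction (P := fun f f' => ∫ x, f x * (ψ x * dφ x) =
      - (∫ x, f x * (ψ' x * φ x)) - ∫ x, f' x * (ψ x * φ x)) ?_ ?_ hf
    · exact isClosed_eq ((continuous_integral_mul (mem1 dφ)).comp continuous_fst)
        (((continuous_integral_mul (mem2 φ)).comp continuous_fst).neg.sub
          ((continuous_integral_mul (mem1 φ)).comp continuous_snd))
    · intro γ
      set dγ := SchwartzMap.derivCLM ℝ ℝ γ with hdγ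
      have i1 : Integrable fun x => γ x * (ψ x * dφ x) := (γ.memLp 2 volume).integrable_mul (mem1 dφ)
      have i2 : Integrable fun x => γ x * (ψ' x * φ x) := (γ.memLp 2 volume).integrable_mul (mem2 φ)
      have i3 : Integrable fun x => dγ x * (ψ x * φ x) := (dγ.memLp 2 volume).integrable_mul (mem1 φ)
      have i4 : Integrable fun x => γ x * (ψ x * φ x) := (γ.memLp 2 volume).integrable_mul (mem1 φ)
      have ibp := integral_mul_deriv_eq_deriv_mul_of_integrable
        (u := fun x => γ x * ψ x) (u' := fun x => dγ x * ψ x + γ x * ψ' x) (v := φ) (v' := dφ)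
        (fun x _ => (γ.hasDerivAt x).mul (hψ x)) (fun x _ => φ.hasDerivAt x)
        (by convert! i1 using 1; ext x; simp only [Pi.mul_apply]; ring)
        (by convert! i2.add i3 using 1; ext x; simp only [Pi.mul_apply, Pi.add_apply]; ring)
        (by convert! i4 using 1; ext x; simp only [Pi.mul_apply]; ring)
      have e1 : ∫ x, schwartzL2 γ x * (ψ x * dφ x) = ∫ x, γ x * (ψ x * dφ x) := by
        apply integral_congr_ae
        filter_upwards [γ.coeFn_toLp 2 volume] with x hx; rw [hx]
      have e2 : ∫ x, schwartzL2 γ x * (ψ' x * φ x) = ∫ x, γ x * (ψ' x * φ x) := by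
        apply integral_congr_ae
        filter_upwards [γ.coeFn_toLp 2 volume] with x hx; rw [hx]
      have e3 : ∫ x, schwartzL2 dγ x * (ψ x * φ x) = ∫ x, dγ x * (ψ x * φ x) := by
        apply integral_congr_ae
        filter_upwards [dγ.coeFn_toLp 2 volume] with x hx; rw [hx]
      rw [e1, e2, e3]
      have e4 : ∫ x, (dγ x * ψ x + γ x * ψ' x) * φ x =
          (∫ x, γ x * (ψ' x * φ x)) + ∫ x, dγ x * (ψ x * φ x) := by
        rw [← integral_add i2 i3]; congr 1 with x; ring
      have e5 : ∫ x, γ x * (ψ x * dφ x) = ∫ x, γ x * ψ x * dφ x := by congr 1 with x; ring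
      rw [e5, ibp, e4]; ring
  have e1 : ∫ x, F x * deriv φ x = ∫ x, f x * (ψ x * dφ x) := by
    apply integral_congr_ae
    filter_upwards [hF] with x hx
    rw [hx, hdφ, SchwartzMap.derivCLM_apply]; ring
  have e2 : ∫ x, F' x * φ x = (∫ x, f x * (ψ' x * φ x)) + ∫ x, f' x * (ψ x * φ x) := by
    rw [← integral_add (integrable_coeFn_mul f (mem2 φ)) (integrable_coeFn_mul f' (mem1 φ))]
    apply integral_congr_ae
    filter_upwards [hF'] with x hx
    rw [hx]; ring
  rw [e1, e2, key]; ring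

/-! ### The weight `ψ` -/

lemma phi_pos (x : ℝ) : 0 < phi x := Real.log_pos (by nlinarith [sq_nonneg x])

lemma le_phi {M x : ℝ} (hM : 0 ≤ M) (hx : Real.exp M ≤ |x|) : M ≤ phi x := by
  rw [phi, Real.le_log_iff_exp_le (by positivity)]
  have h1 : 1 ≤ Real.exp M := Real.one_le_exp hM
  nlinarith [sq_abs x]

lemma psi_nonneg {t : ℝ} (ht : 0 ≤ t) (x : ℝ) : 0 ≤ psi t x := by
  refine mul_nonneg (phi_pos x).le (sub_nonneg.mpr (Real.exp_le_one_iff.mpr ?_))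
  have := div_nonneg ht (phi_pos x).le
  linarith

lemma psi_le (t x : ℝ) : psi t x ≤ t := by
  have h := phi_pos x
  have h1 := Real.add_one_le_exp (-(t / phi x))
  calc psi t x ≤ phi x * (t / phi x) := mul_le_mul_of_nonneg_left (by linarith) h.le
    _ = t := by field_simp

lemma norm_psi_le {t : ℝ} (ht : 0 ≤ t) (x : ℝ) : ‖psi t x‖ ≤ t := by
  rw [Real.norm_of_nonneg (psi_nonneg ht x)]
  exact psi_le t x

/-- The weight is large as soon as both time and `φ` are. -/
lemma le_psi {M t x : ℝ} (hM : 0 < M) (ht : M ≤ t) (hx : M ≤ phi x) : M / 2 ≤ psi t x := by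
  have h := phi_pos x
  set z := t / phi x with hz
  have hz0 : 0 < z := div_pos (hM.trans_le ht) h
  have htz : t = phi x * z := by rw [hz]; field_simp
  have h1 : Real.exp (-z) ≤ 1 / (1 + z) := by
    rw [Real.exp_neg, ← one_div]
    exact one_div_le_one_div_of_le (by positivity) (by linarith [Real.add_one_le_exp z])
  have h2 : z / (1 + z) ≤ 1 - Real.exp (-z) := by
    have : z / (1 + z) = 1 - 1 / (1 + z) := by field_simp; ring
    linarith
  calc M / 2 ≤ phi x * (z / (1 + z)) := by
        rw [← mul_div_assoc, div_le_div_iff₀ (by norm_num) (by positivity)]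
        nlinarith
    _ ≤ psi t x := mul_le_mul_of_nonneg_left h2 h.le

/-- The space derivative of the weight `ψ`. -/
def psiDeriv (t x : ℝ) : ℝ :=
  2 * x / (x ^ 2 + 2) * (1 - Real.exp (-(t / phi x)) * (1 + t / phi x))

lemma hasDerivAt_psi (t x : ℝ) : HasDerivAt (psi t) (psiDeriv t x) x := by
  have h := phi_pos x
  have h2 : (x ^ 2 + 2 : ℝ) ≠ 0 := by positivity
  have h1 : HasDerivAt phi (2 * x / (x ^ 2 + 2)) x := by
    have := ((hasDerivAt_pow 2 x).add_const (2 : ℝ)).log h2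
    simpa using! this
  have h3 : HasDerivAt (fun y => Real.exp (-(t / phi y)))
      (Real.exp (-(t / phi x)) * -((0 * phi x - t * (2 * x / (x ^ 2 + 2))) / phi x ^ 2)) x :=
    (((hasDerivAt_const x t).div h1 h.ne').neg).exp
  have h4 := h1.mul (h3.const_sub 1)
  convert! h4 using 1
  rw [psiDeriv]
  field_simp
  ring

lemma norm_psiDeriv_le {t : ℝ} (ht : 0 ≤ t) (x : ℝ) : ‖psiDeriv t x‖ ≤ 1 := by
  have hz : 0 ≤ t / phi x := div_nonneg ht (phi_pos x).le
  set z := t / phi x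
  have h1 : Real.exp (-z) * (1 + z) ≤ 1 := by
    have := Real.add_one_le_exp z
    have h2 : Real.exp (-z) * Real.exp z = 1 := by rw [← Real.exp_add]; simp
    nlinarith [Real.exp_pos (-z)]
  have h0 : 0 ≤ Real.exp (-z) * (1 + z) := by positivity
  rw [psiDeriv, norm_mul, Real.norm_eq_abs, Real.norm_eq_abs]
  have h3 : |2 * x / (x ^ 2 + 2)| ≤ 1 := by
    rw [abs_div, abs_of_pos (by positivity : (0 : ℝ) < x ^ 2 + 2), div_le_one (by positivity),
      abs_le]
    constructor <;> nlinarith [sq_nonneg (x - 1), sq_nonneg (x + 1)]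
  have h4 : |1 - Real.exp (-z) * (1 + z)| ≤ 1 := by
    rw [abs_le]; constructor <;> linarith
  exact mul_le_one₀ h3 (abs_nonneg _) h4

lemma measurable_phi : Measurable phi := by unfold phi; fun_prop

lemma measurable_psi (t : ℝ) : Measurable (psi t) := by
  have := measurable_phi
  unfold psi; fun_prop

lemma measurable_psiDeriv (t : ℝ) : Measurable (psiDeriv t) := by
  have := measurable_phi
  unfold psiDeriv; fun_prop

lemma psiMul_eq_mulOp {t : ℝ} (ht : 0 ≤ t) (f : L2) :
    psiMul t f = mulOp (psi t) (measurable_psi t) t (norm_psi_le ht) f := by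
  have h : MemLp (fun x => psi t x * f x) 2 volume :=
    memLp_bdd_mul (measurable_psi t) (norm_psi_le ht) f
  rw [psiMul, toL2, dif_pos h]
  rfl

lemma psiMul_coeFn {t : ℝ} (ht : 0 ≤ t) (f : L2) : psiMul t f =ᵐ[volume] fun x => psi t x * f x := by
  rw [psiMul_eq_mulOp ht]
  exact mulOp_coeFn _ _ _

/-! ### Uniform approximation by the basis of functions bounded in a weighted `H¹` space -/

lemma tendsto_proj (e : HilbertBasis ℕ ℝ L2) (x : L2) :
    Tendsto (fun N => proj e N x) atTop (𝓝 x) := by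
  let U : ℕ → Submodule ℝ L2 := fun N => Submodule.span ℝ (Set.range fun i : Fin N => e i)
  have hfin : ∀ N, FiniteDimensional ℝ (U N) := fun N =>
    FiniteDimensional.span_of_finite ℝ (Set.finite_range _)
  refine Submodule.starProjection_tendsto_self U ?_ x ?_
  · intro m n hmn
    apply Submodule.span_mono
    rintro _ ⟨i, rfl⟩
    exact ⟨Fin.castLE hmn i, rfl⟩
  · rw [← e.dense_span]
    apply Submodule.topologicalClosure_mono
    rw [Submodule.span_le]
    rintro _ ⟨i, rfl⟩
    apply Submodule.mem_iSup_of_mem (i + 1)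
    exact Submodule.subset_span ⟨Fin.last i, rfl⟩

lemma norm_sub_proj_le (e : HilbertBasis ℕ ℝ L2) (N : ℕ) (x : L2) : ‖x - proj e N x‖ ≤ ‖x‖ := by
  have : FiniteDimensional ℝ (Submodule.span ℝ (Set.range fun i : Fin N => e i)) :=
    FiniteDimensional.span_of_finite ℝ (Set.finite_range _)
  have h :=
    (Submodule.span ℝ (Set.range fun i : Fin N => e i)).norm_sq_eq_add_norm_sq_starProjection x
  rw [Submodule.starProjection_orthogonal'] at h
  apply abs_le_of_sq_le_sq' _ (norm_nonneg x) |>.2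
  rw [h]
  exact le_add_of_nonneg_left (by positivity)

lemma coeFn_sum {ι : Type*} (s : Finset ι) (F : ι → L2) :
    (↑(∑ i ∈ s, F i) : ℝ → ℝ) =ᵐ[volume] fun x => ∑ i ∈ s, F i x := by
  classical
  induction s using Finset.induction_on with
  | empty => simpa using! Lp.coeFn_zero ℝ 2 volume
  | insert i s hi ih =>
    rw [Finset.sum_insert hi]
    filter_upwards [Lp.coeFn_add (F i) (∑ i ∈ s, F i), ih] with x h1 h2
    rw [h1, Pi.add_apply, h2, Finset.sum_insert hi]

/-- Hölder continuity of Schwartz functions, with the constant of the `H¹` embedding. -/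
lemma schwartz_sub_le (φ : 𝓢(ℝ, ℝ)) {x y : ℝ} (hxy : x ≤ y) :
    |φ y - φ x| ≤ Real.sqrt (y - x) * ‖schwartzL2 (SchwartzMap.derivCLM ℝ ℝ φ)‖ := by
  set φ' := SchwartzMap.derivCLM ℝ ℝ φ with hφ'
  have h1 : φ y - φ x = ∫ z in Set.Ioc x y, φ' z := by
    rw [← intervalIntegral.integral_of_le hxy]
    exact (intervalIntegral.integral_eq_sub_of_hasDerivAt (fun z _ => φ.hasDerivAt z)
      (φ'.continuous.intervalIntegrable _ _)).symm
  have hfin : volume (Set.Ioc x y) ≠ ∞ := by simp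
  have h2 : ∫ z in Set.Ioc x y, φ' z =
      inner ℝ (indicatorConstLp 2 measurableSet_Ioc hfin (1 : ℝ)) (schwartzL2 φ') := by
    rw [L2.inner_indicatorConstLp_one]
    apply integral_congr_ae
    exact ae_restrict_of_ae ((φ'.coeFn_toLp 2 volume).symm)
  rw [h1, h2]
  refine (abs_real_inner_le_norm _ _).trans ?_
  rw [norm_indicatorConstLp (by norm_num) (by norm_num)]
  apply le_of_eq
  congr 1
  simp [Measure.real, hxy, Real.sqrt_eq_rpow]

/-- The cell `[j/m, (j+1)/m)` of the grid of mesh `1/m`. -/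
def cell (m : ℕ) (j : ℤ) : Set ℝ := {x | ⌊(m : ℝ) * x⌋ = j}

lemma measurableSet_cell (m : ℕ) (j : ℤ) : MeasurableSet (cell m j) :=
  (Int.measurable_floor.comp (measurable_const_mul (m : ℝ))) (measurableSet_singleton j)

lemma cell_subset {m : ℕ} (hm : 0 < m) (j : ℤ) :
    cell m j ⊆ Set.Icc ((j : ℝ) / m) ((j : ℝ) / m + 1 / m) := by
  intro x hx
  have hm' : (0 : ℝ) < m := by exact_mod_cast hm
  have h1 : ⌊(m : ℝ) * x⌋ = j := hx
  have h2 := Int.floor_le ((m : ℝ) * x)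
  have h3 := Int.lt_floor_add_one ((m : ℝ) * x)
  rw [h1] at h2 h3
  constructor
  · rw [div_le_iff₀ hm']; linarith
  · rw [← add_div, le_div_iff₀ hm']; linarith

lemma volume_cell_ne_top {m : ℕ} (hm : 0 < m) (j : ℤ) : volume (cell m j) ≠ ∞ :=
  ((measure_mono (cell_subset hm j)).trans_lt (by simp)).ne

lemma sum_indicator_cell (m : ℕ) (s : Finset ℤ) (c : ℤ → ℝ) (x : ℝ) :
    ∑ j ∈ s, c j * (cell m j).indicator (fun _ => (1 : ℝ)) x =
      if ⌊(m : ℝ) * x⌋ ∈ s then c ⌊(m : ℝ) * x⌋ else 0 := by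
  have : ∀ j, c j * (cell m j).indicator (fun _ => (1 : ℝ)) x =
      if ⌊(m : ℝ) * x⌋ = j then c j else 0 := by
    intro j
    by_cases h : ⌊(m : ℝ) * x⌋ = j
    · rw [Set.indicator_of_mem (show x ∈ cell m j from h)]; simp [h]
    · rw [Set.indicator_of_notMem (show x ∉ cell m j from h)]; simp [h]
  simp_rw [this]
  rw [Finset.sum_ite_eq]

/-- Step functions on a fixed finite grid approximate Schwartz functions in `L²`, uniformly on sets
where the derivative and the weighted function `ψ(t, ·) φ` are bounded in `L²`: the weight controls
the tails, and Hölder continuity controls the oscillation on each cell. -/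
lemma exists_step_approx {κ : ℝ} (hκ0 : 0 < κ) :
    ∃ T : ℝ, 0 < T ∧ ∃ (s : Finset ℤ) (p : ℤ → ℝ) (χ : ℤ → L2), ∀ t, T ≤ t → ∀ φ : 𝓢(ℝ, ℝ),
      ‖schwartzL2 φ - ∑ j ∈ s, φ (p j) • χ j‖ ≤
        κ * (‖psiMul t (schwartzL2 φ)‖ + ‖schwartzL2 (SchwartzMap.derivCLM ℝ ℝ φ)‖) := by
  -- outside `[-L, L)` the weight is at least `T / 2 = 1 / κ`, and the mesh `1 / m` is so small that
  -- the oscillation on the cells contributes at most `κ` times the norm of the derivative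
  set T : ℝ := 2 / κ with hT
  have hT0 : 0 < T := by positivity
  obtain ⟨L, hL⟩ := exists_nat_ge (Real.exp T)
  have hL0 : (0 : ℝ) < L := (Real.exp_pos T).trans_le hL
  obtain ⟨m, hm⟩ := exists_nat_ge (2 * L / κ ^ 2)
  have hm0 : (0 : ℝ) < m := lt_of_lt_of_le (by positivity) hm
  have hmN : 0 < m := by exact_mod_cast hm0
  set s : Finset ℤ := Finset.Ico (-(L * m : ℤ)) (L * m) with hs
  set χ : ℤ → L2 := fun j =>
    indicatorConstLp 2 (measurableSet_cell m j) (volume_cell_ne_top hmN j) (1 : ℝ) with hχ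
  refine ⟨T, hT0, s, fun j => (j : ℝ) / m, χ, fun t ht φ => ?_⟩
  have ht0 : 0 ≤ t := hT0.le.trans ht
  rw [psiMul_eq_mulOp ht0]
  set φ' := SchwartzMap.derivCLM ℝ ℝ φ with hφ'
  set Ψ := mulOp (psi t) (measurable_psi t) t (norm_psi_le ht0) (schwartzL2 φ) with hΨ
  -- the step function interpolating `φ` at the left end points of the cells inside `[-L, L)`
  set S : L2 := ∑ j ∈ s, φ ((j : ℝ) / m) • χ j with hS
  have hScoe : ∀ᵐ x, S x = if ⌊(m : ℝ) * x⌋ ∈ s then φ ((⌊(m : ℝ) * x⌋ : ℝ) / m) else 0 := by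
    have h1 := coeFn_sum s (fun j : ℤ => φ ((j : ℝ) / m) • χ j)
    have h2 : ∀ᵐ x, ∀ j : ℤ, (φ ((j : ℝ) / m) • χ j : L2) x =
        φ ((j : ℝ) / m) * (cell m j).indicator (fun _ => (1 : ℝ)) x := by
      rw [ae_all_iff]
      intro j
      filter_upwards [Lp.coeFn_smul (φ ((j : ℝ) / m)) (χ j),
        indicatorConstLp_coeFn (p := 2) (hs := measurableSet_cell m j)
          (hμs := volume_cell_ne_top hmN j) (c := (1 : ℝ))] with x h3 h4
      rw [h3, Pi.smul_apply, smul_eq_mul, hχ, h4]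
    filter_upwards [h1, h2] with x h3 h4
    rw [hS, h3]
    rw [Finset.sum_congr rfl fun j _ => h4 j]
    exact sum_indicator_cell m s (fun j => φ ((j : ℝ) / m)) x
  have hfin : volume (Set.Icc (-(L : ℝ)) L) ≠ ∞ := by simp
  set I : L2 := indicatorConstLp 2 measurableSet_Icc hfin (1 : ℝ) with hI
  set c : ℝ := Real.sqrt (1 / m) * ‖schwartzL2 φ'‖ with hc
  have hc0 : 0 ≤ c := by positivity
  have hIcoe : ∀ᵐ x, I x = (Set.Icc (-(L : ℝ)) L).indicator (fun _ => (1 : ℝ)) x :=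
    indicatorConstLp_coeFn
  have hmem : ∀ x : ℝ, ⌊(m : ℝ) * x⌋ ∈ s ↔ x ∈ Set.Ico (-(L : ℝ)) L := by
    intro x
    rw [hs, Finset.mem_Ico, Int.le_floor, Int.floor_lt, Set.mem_Ico]
    push_cast
    constructor
    · rintro ⟨h1, h2⟩; constructor <;> nlinarith
    · rintro ⟨h1, h2⟩; constructor <;> nlinarith
  have hdiff : ‖schwartzL2 φ - S‖ ≤ κ * ‖Ψ‖ + c * ‖I‖ := by
    have h1 : ‖schwartzL2 φ - S‖ ≤ ‖|κ • Ψ| + c • I‖ := by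
      apply Lp.norm_le_norm_of_ae_le
      filter_upwards [Lp.coeFn_sub (schwartzL2 φ) S, φ.coeFn_toLp 2 volume, hScoe, hIcoe,
        Lp.coeFn_add |κ • Ψ| (c • I), Lp.coeFn_smul c I, Lp.coeFn_abs (κ • Ψ),
        Lp.coeFn_smul κ Ψ, mulOp_coeFn (measurable_psi t) (norm_psi_le ht0) (schwartzL2 φ)]
        with x h1 h2 h3 h4 h5 h6 h7 h8 h9
      rw [h1, Pi.sub_apply, h2, h3, h5, Pi.add_apply, h6, h7, Pi.smul_apply, h8, Pi.smul_apply,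
        h4, hΨ, h9, h2, smul_eq_mul, smul_eq_mul, Real.norm_eq_abs, Real.norm_eq_abs]
      refine le_trans ?_ (le_abs_self _)
      by_cases hx : x ∈ Set.Ico (-(L : ℝ)) L
      · rw [if_pos ((hmem x).mpr hx), Set.indicator_of_mem (Set.Ico_subset_Icc_self hx), mul_one]
        have hcell := cell_subset hmN ⌊(m : ℝ) * x⌋ (show x ∈ cell m ⌊(m : ℝ) * x⌋ from rfl)
        refine le_trans ?_ (le_add_of_nonneg_left (abs_nonneg _))
        refine (schwartz_sub_le φ hcell.1).trans ?_
        apply mul_le_mul_of_nonneg_right _ (norm_nonneg _)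
        apply Real.sqrt_le_sqrt
        linarith [hcell.2]
      · rw [if_neg (mt (hmem x).mp hx), sub_zero]
        refine le_trans ?_ (le_add_of_nonneg_right
          (mul_nonneg hc0 (Set.indicator_nonneg (fun _ _ => zero_le_one) _)))
        have hxL : (L : ℝ) ≤ |x| := by
          rw [Set.mem_Ico, not_and_or, not_le, not_lt] at hx
          rcases hx with hx | hx
          · linarith [neg_le_abs x]
          · exact hx.trans (le_abs_self x)
        have hpsi := le_psi hT0 ht (le_phi hT0.le (hL.trans hxL))
        have h10 : 1 ≤ κ * psi t x := by
          have : κ * (T / 2) = 1 := by rw [hT]; field_simp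
          nlinarith
        rw [← mul_assoc, abs_mul, abs_of_pos (by linarith : 0 < κ * psi t x)]
        nlinarith [abs_nonneg (φ x)]
    refine h1.trans ((norm_add_le _ _).trans ?_)
    rw [norm_abs_eq_norm, norm_smul, norm_smul, Real.norm_of_nonneg hκ0.le, Real.norm_of_nonneg hc0]
  have hcI : c * ‖I‖ ≤ κ * ‖schwartzL2 φ'‖ := by
    rw [hc, hI, norm_indicatorConstLp (by norm_num) (by norm_num)]
    have h1 : (volume.real (Set.Icc (-(L : ℝ)) L)) = 2 * L := by
      simp [Measure.real]; ring
    rw [h1]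
    simp only [norm_one, one_mul, ENNReal.toReal_ofNat]
    rw [← Real.sqrt_eq_rpow, mul_right_comm, ← Real.sqrt_mul (by positivity)]
    apply mul_le_mul_of_nonneg_right _ (norm_nonneg _)
    apply Real.sqrt_le_iff.mpr ⟨hκ0.le, ?_⟩
    rw [div_le_iff₀ (by positivity)] at hm
    rw [div_mul_eq_mul_div, one_mul, div_le_iff₀ hm0]
    linarith
  linarith

/-- Functions bounded in `H¹` and in `L²` with a weight tending to infinity form a precompact
subset of `L²`, on which the projections `P_N` converge uniformly to the identity. -/
theorem exists_norm_sub_proj_le (e : HilbertBasis ℕ ℝ L2) {δ : ℝ} (hδ : 0 < δ) :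
    ∃ T : ℝ, 0 < T ∧ ∃ N : ℕ, 1 ≤ N ∧ ∀ t, T ≤ t → ∀ F F' : L2, HasWeakDeriv F F' →
      ‖F - proj e N F‖ ≤ δ * (‖F‖ + ‖F'‖ + ‖psiMul t F‖) := by
  set κ := δ / 2 with hκ
  have hκ0 : 0 < κ := by positivity
  obtain ⟨T, hT0, s, p, χ, happrox⟩ := exists_step_approx hκ0
  have hlim : Tendsto (fun N => ∑ j ∈ s, ‖χ j - proj e N (χ j)‖) atTop (𝓝 0) := by
    have : Tendsto (fun N => ∑ j ∈ s, ‖χ j - proj e N (χ j)‖) atTop (𝓝 (∑ j ∈ s, ‖χ j - χ j‖)) :=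
      tendsto_finsetSum _ fun j _ => (tendsto_const_nhds.sub (tendsto_proj e (χ j))).norm
    simpa using this
  obtain ⟨N, hN, hN1⟩ := ((hlim.eventually (gt_mem_nhds hκ0)).and (eventually_ge_atTop 1)).exists
  refine ⟨T, hT0, N, hN1, fun t ht F F' hF => ?_⟩
  have ht0 : 0 ≤ t := hT0.le.trans ht
  refine HasWeakDeriv.closed_induction (P := fun F F' => ‖F - proj e N F‖ ≤ δ * (‖F‖ + ‖F'‖ +
    ‖psiMul t F‖)) ?_ ?_ hF
  · simp only [psiMul_eq_mulOp ht0]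
    apply isClosed_le <;> fun_prop
  intro φ
  have hd := happrox t ht φ
  set φ' := SchwartzMap.derivCLM ℝ ℝ φ with hφ'
  set S : L2 := ∑ j ∈ s, φ (p j) • χ j with hS
  have hSP : ‖S - proj e N S‖ ≤ κ * (‖schwartzL2 φ‖ + ‖schwartzL2 φ'‖) := by
    have h1 : S - proj e N S = ∑ j ∈ s, φ (p j) • (χ j - proj e N (χ j)) := by
      rw [hS, map_sum, ← Finset.sum_sub_distrib]
      simp only [map_smul, smul_sub]
    rw [h1]
    calc _ ≤ ∑ j ∈ s, (‖schwartzL2 φ‖ + ‖schwartzL2 φ'‖) * ‖χ j - proj e N (χ j)‖ := by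
          refine norm_sum_le_of_le _ fun j _ => ?_
          rw [norm_smul, Real.norm_eq_abs]
          exact mul_le_mul_of_nonneg_right (schwartz_abs_le φ _) (norm_nonneg _)
      _ = (‖schwartzL2 φ‖ + ‖schwartzL2 φ'‖) * ∑ j ∈ s, ‖χ j - proj e N (χ j)‖ := by
          rw [Finset.mul_sum]
      _ ≤ _ := by
          rw [mul_comm]
          exact mul_le_mul_of_nonneg_right hN.le (by positivity)
  have hsplit : schwartzL2 φ - proj e N (schwartzL2 φ) =
      ((schwartzL2 φ - S) - proj e N (schwartzL2 φ - S)) + (S - proj e N S) := by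
    rw [map_sub]; abel
  rw [hsplit]
  refine (norm_add_le _ _).trans ?_
  have h5 := norm_sub_proj_le e N (schwartzL2 φ - S)
  have h6 : δ = 2 * κ := by rw [hκ]; ring
  rw [h6]
  have h7 := mul_nonneg hκ0.le (norm_nonneg (psiMul t (schwartzL2 φ)))
  have h8 := mul_nonneg hκ0.le (norm_nonneg (schwartzL2 φ))
  have h9 := mul_nonneg hκ0.le (norm_nonneg (schwartzL2 φ'))
  linarith

/-! ### The equation on the Fourier side -/

lemma continuous_pairing_complex {w : ℝ → L2} (hw : Continuous w) (θ : 𝓢(ℝ, ℂ)) :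
    Continuous fun r => ∫ x, (w r x : ℂ) * θ x := by
  have h : (fun r => ∫ x, (w r x : ℂ) * θ x) = fun r =>
      (((∫ x, w r x * schwartzRe θ x : ℝ) : ℂ) +
        ((∫ x, w r x * schwartzIm θ x : ℝ) : ℂ) * Complex.I) := by
    funext r
    rw [← integral_ofReal_mul_re, ← integral_ofReal_mul_im, Complex.re_add_im]
  rw [h]
  have h1 := (continuous_integral_mul ((schwartzRe θ).memLp 2 volume)).comp hw
  have h2 := (continuous_integral_mul ((schwartzIm θ).memLp 2 volume)).comp hw
  exact (Complex.continuous_ofReal.comp h1).add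
    ((Complex.continuous_ofReal.comp h2).mul continuous_const)

/-- The linear fourth order equation `w_t + a w + w_xxxx + G = 0`, integrated in time and tested
against real Schwartz functions. -/
def SolvesLinear (a : ℝ) (w G : ℝ → L2) : Prop :=
  ∀ φ : 𝓢(ℝ, ℝ), ∀ t, 0 ≤ t →
    ∫ x, w t x * φ x = (∫ x, w 0 x * φ x) - ∫ r in (0 : ℝ)..t,
      (a * (∫ x, w r x * φ x) + (∫ x, w r x * iteratedDeriv 4 φ x) + ∫ x, G r x * φ x)

/-- The fourth derivative of a complex Schwartz function. -/
def schwartzD4 (θ : 𝓢(ℝ, ℂ)) : 𝓢(ℝ, ℂ) :=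
  SchwartzMap.derivCLM ℝ ℂ (SchwartzMap.derivCLM ℝ ℂ (SchwartzMap.derivCLM ℝ ℂ
    (SchwartzMap.derivCLM ℝ ℂ θ)))

lemma deriv_schwartzIm_eq (Φ : 𝓢(ℝ, ℂ)) :
    SchwartzMap.derivCLM ℝ ℝ (schwartzIm Φ) = schwartzIm (SchwartzMap.derivCLM ℝ ℂ Φ) := by
  ext x
  exact deriv_schwartzIm Φ x

lemma iteratedDeriv_four_eq (φ : 𝓢(ℝ, ℝ)) :
    iteratedDeriv 4 φ = SchwartzMap.derivCLM ℝ ℝ (SchwartzMap.derivCLM ℝ ℝ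
      (SchwartzMap.derivCLM ℝ ℝ (SchwartzMap.derivCLM ℝ ℝ φ))) := by
  have (φ : 𝓢(ℝ, ℝ)) : deriv φ = SchwartzMap.derivCLM ℝ ℝ φ := rfl
  rw [iteratedDeriv_succ', iteratedDeriv_succ', iteratedDeriv_succ', iteratedDeriv_one, this, this,
    this, this]

lemma iteratedDeriv_schwartzRe (θ : 𝓢(ℝ, ℂ)) (x : ℝ) :
    iteratedDeriv 4 (schwartzRe θ) x = schwartzRe (schwartzD4 θ) x := by
  rw [iteratedDeriv_four_eq, schwartzD4]
  simp only [deriv_schwartzRe_eq]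

lemma iteratedDeriv_schwartzIm (θ : 𝓢(ℝ, ℂ)) (x : ℝ) :
    iteratedDeriv 4 (schwartzIm θ) x = schwartzIm (schwartzD4 θ) x := by
  rw [iteratedDeriv_four_eq, schwartzD4]
  simp only [deriv_schwartzIm_eq]

/-- The linear equation tested against complex Schwartz functions. -/
lemma SolvesLinear.complex {a : ℝ} {w G : ℝ → L2} (h : SolvesLinear a w G) (hw : Continuous w)
    (hG : Continuous G) (θ : 𝓢(ℝ, ℂ)) {t : ℝ} (ht : 0 ≤ t) :
    ∫ x, (w t x : ℂ) * θ x = (∫ x, (w 0 x : ℂ) * θ x) - ∫ r in (0 : ℝ)..t,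
      ((a : ℂ) * (∫ x, (w r x : ℂ) * θ x) + (∫ x, (w r x : ℂ) * schwartzD4 θ x)
        + ∫ x, (G r x : ℂ) * θ x) := by
  have hc : Continuous fun r => ((a : ℂ) * (∫ x, (w r x : ℂ) * θ x)
      + (∫ x, (w r x : ℂ) * schwartzD4 θ x) + ∫ x, (G r x : ℂ) * θ x) :=
    ((continuous_const.mul (continuous_pairing_complex hw θ)).add
      (continuous_pairing_complex hw (schwartzD4 θ))).add (continuous_pairing_complex hG θ)
  have hi := hc.intervalIntegrable (μ := volume) 0 t
  apply Complex.ext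
  · have h1 := Complex.reCLM.intervalIntegral_comp_comm hi
    simp only [Complex.reCLM_apply] at h1
    rw [Complex.sub_re, ← h1]
    simp only [Complex.add_re, Complex.re_ofReal_mul, integral_ofReal_mul_re]
    rw [h _ t ht]
    simp only [iteratedDeriv_schwartzRe]
  · have h1 := Complex.imCLM.intervalIntegral_comp_comm hi
    simp only [Complex.imCLM_apply] at h1
    rw [Complex.sub_im, ← h1]
    simp only [Complex.add_im, Complex.im_ofReal_mul, integral_ofReal_mul_im]
    rw [h _ t ht]
    simp only [iteratedDeriv_schwartzIm]

/-- Multiplication of a Schwartz function by `(2πξ)⁴`. -/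
def mulFreq4 (θ : 𝓢(ℝ, ℂ)) : 𝓢(ℝ, ℂ) := mulFreq (mulFreq (mulFreq (mulFreq θ)))

lemma mulFreq4_apply (θ : 𝓢(ℝ, ℂ)) (ξ : ℝ) :
    mulFreq4 θ ξ = (((2 * Real.pi * ξ) ^ 4 : ℝ) : ℂ) * θ ξ := by
  simp only [mulFreq4, mulFreq_apply]
  push_cast
  linear_combination (2 * (Real.pi : ℂ) * ξ) ^ 4 * θ ξ * (Complex.I ^ 2 - 1) * Complex.I_sq

/-- Differentiation of a Fourier transform is multiplication by `-2πiξ` before transforming. -/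
lemma derivCLM_fourier (θ : 𝓢(ℝ, ℂ)) :
    SchwartzMap.derivCLM ℝ ℂ (𝓕 θ) = 𝓕 (-mulFreq θ) := by
  ext x
  rw [SchwartzMap.derivCLM_apply, deriv_fourier_schwartz, FourierTransform.fourier_neg]
  rfl

lemma mulFreq_neg (θ : 𝓢(ℝ, ℂ)) : mulFreq (-θ) = - mulFreq θ := by
  ext ξ; simp

lemma schwartzD4_fourier (θ : 𝓢(ℝ, ℂ)) : schwartzD4 (𝓕 θ) = 𝓕 (mulFreq4 θ) := by
  simp only [schwartzD4, derivCLM_fourier, mulFreq_neg, neg_neg, mulFreq4]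

/-- The linear equation on the Fourier side, where `∂ₓ⁴` becomes multiplication by `(2πξ)⁴`. -/
lemma SolvesLinear.fourier {a : ℝ} {w G : ℝ → L2} (h : SolvesLinear a w G) (hw : Continuous w)
    (hG : Continuous G) (θ : 𝓢(ℝ, ℂ)) {t : ℝ} (ht : 0 ≤ t) :
    ∫ ξ, fhat (w t) ξ * θ ξ = (∫ ξ, fhat (w 0) ξ * θ ξ) - ∫ r in (0 : ℝ)..t,
      ((a : ℂ) * (∫ ξ, fhat (w r) ξ * θ ξ) + (∫ ξ, fhat (w r) ξ * mulFreq4 θ ξ)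
        + ∫ ξ, fhat (G r) ξ * θ ξ) := by
  have := h.complex hw hG (𝓕 θ) ht
  simpa only [integral_fhat_mul, schwartzD4_fourier] using this

/-- Multiplication by a Schwartz function, as an operator on `L²`. -/
def mulS (θ : 𝓢(ℝ, ℂ)) : CL2 →L[ℂ] CL2 :=
  mulOp θ θ.continuous.measurable _ (SchwartzMap.norm_le_seminorm ℝ θ)

lemma mulS_coeFn (θ : 𝓢(ℝ, ℂ)) (F : CL2) : mulS θ F =ᵐ[volume] fun ξ => θ ξ * F ξ :=
  mulOp_coeFn _ _ _

/-- Integration against a Schwartz function, as a continuous linear functional on `L²`. -/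
def pairS (θ : 𝓢(ℝ, ℂ)) : CL2 →L[ℂ] ℂ :=
  innerSL ℂ ((θ.memLp 2 volume).star.toLp : CL2)

lemma pairS_apply (θ : 𝓢(ℝ, ℂ)) (F : CL2) : pairS θ F = ∫ ξ, F ξ * θ ξ := by
  rw [pairS, innerSL_apply_apply, L2.inner_def]
  apply integral_congr_ae
  filter_upwards [((θ.memLp 2 volume).star).coeFn_toLp] with ξ hξ
  rw [hξ]
  simp

lemma eq_of_pairS_eq {F F' : CL2} (h : ∀ θ, pairS θ F = pairS θ F') : F = F' := by
  apply Lp.ext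
  apply ae_eq_of_integral_schwartz ((Lp.memLp _).locallyIntegrable (by norm_num))
    ((Lp.memLp _).locallyIntegrable (by norm_num))
  intro θ
  rw [← pairS_apply, ← pairS_apply, h]

lemma pairS_mulS (θ ρ : 𝓢(ℝ, ℂ)) (F : CL2) :
    pairS θ (mulS ρ F) = ∫ ξ, F ξ * (ρ ξ * θ ξ) := by
  rw [pairS_apply]
  apply integral_congr_ae
  filter_upwards [mulS_coeFn ρ F] with ξ hξ
  rw [hξ]; ring

/-- A frequency truncation of the solution satisfies the equation integrated in time in `L²`: for a
Schwartz multiplier `ρ` the operator `(2πξ)⁴ ρ` is bounded. -/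
lemma SolvesLinear.mulS_eq {a : ℝ} {w G : ℝ → L2} (h : SolvesLinear a w G) (hw : Continuous w)
    (hG : Continuous G) (ρ : 𝓢(ℝ, ℂ)) {t : ℝ} (ht : 0 ≤ t) :
    mulS ρ (fhat (w t)) = mulS ρ (fhat (w 0)) - ∫ r in (0 : ℝ)..t,
      (mulS ((a : ℂ) • ρ + mulFreq4 ρ) (fhat (w r)) + mulS ρ (fhat (G r))) := by
  have hc : Continuous fun r =>
      mulS ((a : ℂ) • ρ + mulFreq4 ρ) (fhat (w r)) + mulS ρ (fhat (G r)) := by fun_prop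
  apply eq_of_pairS_eq
  intro θ
  have hi := (pairS θ).intervalIntegral_comp_comm (hc.intervalIntegrable (μ := volume) 0 t)
  rw [map_sub, ← hi]
  set ρθ : 𝓢(ℝ, ℂ) := SchwartzMap.smulLeftCLM ℂ ρ θ with hρθ
  have hρθa : ∀ ξ, ρθ ξ = ρ ξ * θ ξ := fun ξ =>
    SchwartzMap.smulLeftCLM_apply_apply ρ.hasTemperateGrowth θ ξ
  have key := h.fourier hw hG ρθ ht
  simp only [mulFreq4_apply, hρθa] at key
  rw [pairS_mulS, pairS_mulS, key]
  congr 1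
  apply intervalIntegral.integral_congr
  intro r _
  simp only [map_add, pairS_mulS]
  congr 1
  rw [← integral_const_mul, ← integral_add]
  · congr 1 with ξ
    simp only [add_apply, smul_apply, mulFreq4_apply, smul_eq_mul]
    ring
  · refine Integrable.const_mul ?_ _
    simpa only [hρθa] using! integrable_mul_of_L2 (Lp.memLp (fhat (w r))) (ρθ.memLp 2 volume)
  · simpa only [hρθa, mulFreq4_apply] using!
      integrable_mul_of_L2 (Lp.memLp (fhat (w r))) ((mulFreq4 ρθ).memLp 2 volume)

/-- A frequency truncation of the solution satisfies an ordinary differential equation in `L²`. -/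
lemma SolvesLinear.hasDerivAt_mulS {a : ℝ} {w G : ℝ → L2} (h : SolvesLinear a w G)
    (hw : Continuous w) (hG : Continuous G) (ρ : 𝓢(ℝ, ℂ)) {t : ℝ} (ht : 0 < t) :
    HasDerivAt (fun t => mulS ρ (fhat (w t)))
      (-(mulS ((a : ℂ) • ρ + mulFreq4 ρ) (fhat (w t)) + mulS ρ (fhat (G t)))) t := by
  have hc : Continuous fun r =>
      mulS ((a : ℂ) • ρ + mulFreq4 ρ) (fhat (w r)) + mulS ρ (fhat (G r)) := by fun_prop
  have h1 := ((hc.integral_hasStrictDerivAt 0 t).hasDerivAt).const_sub (mulS ρ (fhat (w 0)))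
  apply h1.congr_of_eventuallyEq
  filter_upwards [lt_mem_nhds ht] with r hr
  exact h.mulS_eq hw hG ρ hr.le

/-! ### Gronwall's inequality with an integrable coefficient -/

/-- Absolute continuity passes to functions with smaller increments. -/
lemma absolutelyContinuousOnInterval_of_dist_le {f g : ℝ → ℝ} {a b : ℝ}
    (hg : AbsolutelyContinuousOnInterval g a b)
    (h : ∀ x ∈ Set.uIcc a b, ∀ y ∈ Set.uIcc a b, dist (f x) (f y) ≤ dist (g x) (g y)) :
    AbsolutelyContinuousOnInterval f a b := by
  rw [absolutelyContinuousOnInterval_iff] at hg ⊢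
  intro ε hε
  obtain ⟨δ, hδ, H⟩ := hg ε hε
  refine ⟨δ, hδ, fun E hE hsum => lt_of_le_of_lt (Finset.sum_le_sum fun i hi => ?_) (H E hE hsum)⟩
  exact h _ (hE.1 i hi).1 _ (hE.1 i hi).2

/-- Gronwall's inequality in integral form, with a nonnegative integrable coefficient. With `I` the
primitive of `β` and `X` the right-hand side of the hypothesis, `exp (-I) X` is absolutely continuous
and its derivative is nonpositive almost everywhere. -/
lemma gronwall_integral {z β : ℝ → ℝ} {s t : ℝ} (hst : s ≤ t) (hz : ContinuousOn z (Set.Icc s t))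
    (hβ : IntervalIntegrable β volume s t) (hβ0 : ∀ r, 0 ≤ β r)
    (h : ∀ τ ∈ Set.Icc s t, z τ ≤ z s + ∫ r in s..τ, β r * z r) :
    z t ≤ z s * Real.exp (∫ r in s..t, β r) := by
  have hu : Set.uIcc s t = Set.Icc s t := Set.uIcc_of_le hst
  have hβz : IntervalIntegrable (fun r => β r * z r) volume s t :=
    hβ.mul_continuousOn (hu ▸ hz)
  set I : ℝ → ℝ := fun τ => ∫ r in s..τ, β r with hI
  set X : ℝ → ℝ := fun τ => z s + ∫ r in s..τ, β r * z r with hX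
  have hIac : AbsolutelyContinuousOnInterval I s t :=
    hβ.absolutelyContinuousOnInterval_intervalIntegral (by simp)
  have hXac : AbsolutelyContinuousOnInterval X s t := by
    have h1 := hβz.absolutelyContinuousOnInterval_intervalIntegral (c := s) (by simp)
    exact absolutelyContinuousOnInterval_of_dist_le h1 fun x _ y _ => by simp [hX]
  have hI0 : ∀ τ ∈ Set.Icc s t, 0 ≤ I τ := fun τ hτ =>
    intervalIntegral.integral_nonneg hτ.1 fun r _ => hβ0 r
  have hexp : ∀ p q : ℝ, 0 ≤ p → 0 ≤ q → p ≤ q → |Real.exp (-p) - Real.exp (-q)| ≤ |p - q| := by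
    intro p q hp hq hpq
    have h1 : Real.exp (-q) = Real.exp (-p) * Real.exp (-(q - p)) := by
      rw [← Real.exp_add]; congr 1; ring
    have h2 := Real.add_one_le_exp (-(q - p))
    have h3 : Real.exp (-p) ≤ 1 := Real.exp_le_one_iff.mpr (by linarith)
    have h4 : Real.exp (-(q - p)) ≤ 1 := Real.exp_le_one_iff.mpr (by linarith)
    rw [h1, abs_of_nonneg (by nlinarith [Real.exp_pos (-p)]), abs_of_nonpos (by linarith)]
    nlinarith [Real.exp_pos (-p)]
  have hEac : AbsolutelyContinuousOnInterval (fun τ => Real.exp (-I τ)) s t := by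
    refine absolutelyContinuousOnInterval_of_dist_le hIac fun x hx y hy => ?_
    rw [hu] at hx hy
    rw [Real.dist_eq, Real.dist_eq]
    rcases le_total (I x) (I y) with hxy | hxy
    · exact hexp _ _ (hI0 x hx) (hI0 y hy) hxy
    · rw [abs_sub_comm, abs_sub_comm (I x)]
      exact hexp _ _ (hI0 y hy) (hI0 x hx) hxy
  have hprod := hEac.fun_mul hXac
  have hint := hprod.integral_deriv_eq_sub
  have hle : ∫ r in s..t, deriv (fun τ => Real.exp (-I τ) * X τ) r ≤ 0 := by
    rw [intervalIntegral.integral_of_le hst]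
    apply integral_nonpos_of_ae
    rw [EventuallyLE, ae_restrict_iff' measurableSet_Ioc]
    filter_upwards [hβ.ae_hasDerivAt_integral, hβz.ae_hasDerivAt_integral] with r h1 h2 hr
    have hr' : r ∈ Set.uIcc s t := hu ▸ Set.Ioc_subset_Icc_self hr
    have d1 : HasDerivAt I (β r) r := h1 hr' s (by simp)
    have d2 : HasDerivAt X (β r * z r) r := (h2 hr' s (by simp)).const_add (z s)
    have d3 := (d1.neg.exp).mul d2
    have d4 : deriv (fun τ => Real.exp (-I τ) * X τ) r =
        Real.exp (-I r) * -β r * X r + Real.exp (-I r) * (β r * z r) := d3.deriv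
    rw [d4, Pi.zero_apply]
    have h5 := h r (hu ▸ hr')
    have h6 : Real.exp (-I r) * β r * (z r - X r) ≤ 0 :=
      mul_nonpos_of_nonneg_of_nonpos (mul_nonneg (Real.exp_pos _).le (hβ0 r)) (by linarith)
    linarith
  rw [hint] at hle
  have hs : Real.exp (-I s) * X s = z s := by simp [hI, hX]
  rw [hs] at hle
  have h7 : X t ≤ z s * Real.exp (I t) := by
    have h8 : Real.exp (-I t) * Real.exp (I t) = 1 := by rw [← Real.exp_add]; simp
    have h9 : Real.exp (-I t) * X t ≤ z s := by linarith
    calc X t = Real.exp (-I t) * X t * Real.exp (I t) := by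
          rw [mul_right_comm, h8, one_mul]
      _ ≤ _ := mul_le_mul_of_nonneg_right h9 (Real.exp_pos _).le
  exact (h t ⟨hst, le_refl t⟩).trans h7

/-! ### The energy inequality -/

/-- A family of smooth compactly supported truncations of the weight `(1 + (2πξ)²)^(1/2)`. -/
lemma exists_cutoffs : ∃ ρ : ℕ → 𝓢(ℝ, ℝ),
    (∀ n ξ, ρ n ξ ^ 2 ≤ 1 + (2 * Real.pi * ξ) ^ 2) ∧
    ∀ ξ, Tendsto (fun n => ρ n ξ) atTop (𝓝 (Real.sqrt (1 + (2 * Real.pi * ξ) ^ 2))) := by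
  let χ : ℕ → ContDiffBump (0 : ℝ) := fun n =>
    ⟨n + 1, n + 2, by positivity, by linarith⟩
  have hpos : ∀ ξ : ℝ, 0 < 1 + (2 * Real.pi * ξ) ^ 2 := fun ξ => by positivity
  have hsm : ContDiff ℝ (⊤ : ℕ∞) fun ξ : ℝ => Real.sqrt (1 + (2 * Real.pi * ξ) ^ 2) :=
    ContDiff.sqrt (by fun_prop) fun ξ => (hpos ξ).ne'
  have hc : ∀ n, HasCompactSupport fun ξ => χ n ξ * Real.sqrt (1 + (2 * Real.pi * ξ) ^ 2) :=
    fun n => (χ n).hasCompactSupport.mul_right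
  have hd : ∀ n, ContDiff ℝ (⊤ : ℕ∞) fun ξ => χ n ξ * Real.sqrt (1 + (2 * Real.pi * ξ) ^ 2) :=
    fun n => (χ n).contDiff.mul hsm
  have ha : ∀ n ξ, (hc n).toSchwartzMap (hd n) ξ =
    χ n ξ * Real.sqrt (1 + (2 * Real.pi * ξ) ^ 2) := fun n ξ => rfl
  refine ⟨fun n => (hc n).toSchwartzMap (hd n), fun n ξ => ?_, fun ξ => ?_⟩
  · rw [ha, mul_pow, Real.sq_sqrt (hpos ξ).le]
    exact mul_le_of_le_one_left (hpos ξ).le (pow_le_one₀ (χ n).nonneg (χ n).le_one)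
  · apply tendsto_const_nhds.congr'
    obtain ⟨n₀, hn₀⟩ := exists_nat_ge |ξ|
    filter_upwards [eventually_ge_atTop n₀] with n hn
    rw [ha, (χ n).one_of_mem_closedBall, one_mul]
    rw [mem_closedBall_zero_iff, Real.norm_eq_abs]
    have : (n₀ : ℝ) ≤ n := by exact_mod_cast hn
    show |ξ| ≤ (n : ℝ) + 1
    linarith

/-- Convergence of truncated norms to the Sobolev norm. -/
lemma tendsto_norm_sq_sobolevNorm {s : ℝ} {f : L2} (hf : eSobolevSq s f < ∞) {m : ℕ → ℝ → ℝ}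
    {F : ℕ → CL2} (hF : ∀ n, ∀ᵐ ξ, F n ξ = (m n ξ : ℂ) * fhat f ξ)
    (hm : ∀ n ξ, m n ξ ^ 2 ≤ (1 + (2 * Real.pi * ξ) ^ 2) ^ s)
    (hlim : ∀ ξ, Tendsto (fun n => m n ξ ^ 2) atTop (𝓝 ((1 + (2 * Real.pi * ξ) ^ 2) ^ s))) :
    Tendsto (fun n => ‖F n‖ ^ 2) atTop (𝓝 (sobolevNorm s f ^ 2)) := by
  have h1 : ∀ n, ENNReal.ofReal (‖F n‖ ^ 2) =
      ∫⁻ ξ, ENNReal.ofReal (m n ξ ^ 2 * ‖fhat f ξ‖ ^ 2) := by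
    intro n
    rw [ofReal_norm_sq]
    apply lintegral_congr_ae
    filter_upwards [hF n] with ξ hξ
    rw [hξ, enorm_sq_eq_ofReal, norm_mul, mul_pow, Complex.norm_real, Real.norm_eq_abs, sq_abs]
  have h2 : eSobolevSq s f =
      ∫⁻ ξ, ENNReal.ofReal ((1 + (2 * Real.pi * ξ) ^ 2) ^ s * ‖fhat f ξ‖ ^ 2) := by
    rw [eSobolevSq_eq]
    congr 1 with ξ
    rw [enorm_sq_eq_ofReal, ENNReal.ofReal_mul (by positivity)]
  have h3 : Tendsto (fun n => ∫⁻ ξ, ENNReal.ofReal (m n ξ ^ 2 * ‖fhat f ξ‖ ^ 2)) atTop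
      (𝓝 (eSobolevSq s f)) := by
    rw [h2]
    refine tendsto_lintegral_of_dominated_convergence' _ (fun n => ?_)
      (fun n => Eventually.of_forall fun ξ => ENNReal.ofReal_le_ofReal
        (mul_le_mul_of_nonneg_right (hm n ξ) (by positivity))) (h2 ▸ hf.ne)
      (Eventually.of_forall fun ξ => ENNReal.tendsto_ofReal ((hlim ξ).mul_const _))
    have h4 : AEMeasurable (fun ξ => ENNReal.ofReal (‖F n ξ‖ ^ 2)) volume :=
      ((Lp.aestronglyMeasurable (F n)).norm.aemeasurable.pow_const 2).ennreal_ofReal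
    apply h4.congr
    filter_upwards [hF n] with ξ hξ
    rw [hξ, norm_mul, mul_pow, Complex.norm_real, Real.norm_eq_abs, sq_abs]
  have h5 := (ENNReal.tendsto_toReal hf.ne).comp h3
  rw [sobolevNorm_sq]
  refine h5.congr fun n => ?_
  rw [Function.comp_apply, ← h1, ENNReal.toReal_ofReal (by positivity)]

/-- Truncated norms are bounded by the Sobolev norm. -/
lemma norm_le_sobolevNorm {s : ℝ} {f : L2} (hf : eSobolevSq s f < ∞) {m : ℝ → ℝ}
    {F : CL2} (hF : ∀ᵐ ξ, F ξ = (m ξ : ℂ) * fhat f ξ)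
    (hm : ∀ ξ, m ξ ^ 2 ≤ (1 + (2 * Real.pi * ξ) ^ 2) ^ s) :
    ‖F‖ ≤ sobolevNorm s f := by
  apply Real.le_sqrt_of_sq_le
  rw [← ENNReal.ofReal_le_iff_le_toReal hf.ne, ofReal_norm_sq, eSobolevSq_eq]
  apply lintegral_mono_ae
  filter_upwards [hF] with ξ hξ
  rw [hξ, enorm_sq_eq_ofReal, enorm_sq_eq_ofReal, ← ENNReal.ofReal_mul (by positivity)]
  apply ENNReal.ofReal_le_ofReal
  rw [norm_mul, mul_pow, Complex.norm_real, Real.norm_eq_abs, sq_abs]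
  exact mul_le_mul_of_nonneg_right (hm ξ) (by positivity)

/-- The pointwise inequality behind the energy estimate. With `κ = (2πξ)²` the symbol of the
dissipation is `2 (a + κ²)`; after `a` has been spent on the decay, the rest controls
`2 l (1 + κ) - (1 + 2 / a) l²` for every `l ≥ 0`, by Young's inequality and
`(1 + κ)² ≤ (1 + 2 / a) (a + 2 κ²)`. -/
lemma dissipation_bound {a l q κ : ℝ} (ha : 0 < a) (hl : 0 ≤ l) (hq : q ≤ 1 + κ) :
    2 * l * q - (1 + 2 / a) * l ^ 2 ≤ a + 2 * κ ^ 2 := by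
  have hc : 0 < 1 + 2 / a := by positivity
  have h1 : (1 + κ) ^ 2 ≤ (1 + 2 / a) * (a + 2 * κ ^ 2) := by
    have : (1 + 2 / a) * (a + 2 * κ ^ 2) = a + 2 + 2 * κ ^ 2 + 4 / a * κ ^ 2 := by
      field_simp; ring
    rw [this]
    have : 0 ≤ 4 / a * κ ^ 2 := by positivity
    nlinarith [sq_nonneg (κ - 1)]
  have h2 : 2 * l * (1 + κ) ≤ (1 + κ) ^ 2 / (1 + 2 / a) + (1 + 2 / a) * l ^ 2 := by
    rw [← sub_nonneg]
    have : (1 + κ) ^ 2 / (1 + 2 / a) + (1 + 2 / a) * l ^ 2 - 2 * l * (1 + κ) =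
        ((1 + κ) - (1 + 2 / a) * l) ^ 2 / (1 + 2 / a) := by
      field_simp; ring
    rw [this]; positivity
  have h3 : (1 + κ) ^ 2 / (1 + 2 / a) ≤ a + 2 * κ ^ 2 := by
    rw [div_le_iff₀ hc]; linarith
  nlinarith

lemma inner_eq_integral (F G : CL2) : inner ℝ F G = ∫ ξ, inner ℝ (F ξ) (G ξ) := L2.inner_def F G

/-- The truncated energy inequality at a fixed time. Here `F` and `G` are the Fourier transforms of
the solution and of the forcing, and the left-hand side is `exp (-a t)` times the time derivative of
`exp (a t) ‖ρ F‖²`. The parameter `l` is free. -/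
lemma energy_truncated {a l : ℝ} (ha : 0 < a) (hl : 0 ≤ l) (ρ : 𝓢(ℝ, ℝ))
    (hρ : ∀ ξ, ρ ξ ^ 2 ≤ 1 + (2 * Real.pi * ξ) ^ 2) (F G : CL2) :
    a * ‖mulS (schwartzOfReal ρ) F‖ ^ 2 + 2 * inner ℝ (mulS (schwartzOfReal ρ) F)
      (-(mulS ((a : ℂ) • schwartzOfReal ρ + mulFreq4 (schwartzOfReal ρ)) F
        + mulS (schwartzOfReal ρ) G)) ≤
    2 * ‖G‖ * ‖mulS (schwartzOfReal ρ) (mulS (schwartzOfReal ρ) F)‖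
      - 2 * l * ‖mulS (schwartzOfReal ρ) (mulS (schwartzOfReal ρ) F)‖ ^ 2
      + (1 + 2 / a) * l ^ 2 * ‖mulS (schwartzOfReal ρ) F‖ ^ 2 := by
  set R := schwartzOfReal ρ with hR
  set W := mulS R F with hW
  set W2 := mulS R W with hW2
  set V := mulS ((a : ℂ) • R + mulFreq4 R) F with hV
  have hWc : ∀ᵐ ξ, W ξ = (ρ ξ : ℂ) * F ξ := mulS_coeFn R F
  have hW2c : ∀ᵐ ξ, W2 ξ = (ρ ξ : ℂ) * W ξ := mulS_coeFn R W
  have hVc : ∀ᵐ ξ, V ξ = ((a + (2 * Real.pi * ξ) ^ 4 : ℝ) : ℂ) * W ξ := by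
    filter_upwards [mulS_coeFn ((a : ℂ) • R + mulFreq4 R) F, hWc] with ξ h1 h2
    rw [h1, h2]
    simp only [add_apply, smul_apply, mulFreq4_apply, smul_eq_mul, hR, schwartzOfReal_apply]
    push_cast; ring
  have hG : inner ℝ W (mulS R G) = inner ℝ W2 G := by
    rw [inner_eq_integral, inner_eq_integral]
    apply integral_congr_ae
    filter_upwards [mulS_coeFn R G, hW2c] with ξ h1 h2
    rw [h1, h2, hR, schwartzOfReal_apply, Complex.inner, Complex.inner]
    congr 1
    rw [map_mul, Complex.conj_ofReal]; ring
  have hi1 : Integrable fun ξ => ‖W ξ‖ ^ 2 := (Lp.memLp W).integrable_norm_pow (by norm_num)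
  have hi2 : Integrable fun ξ => ‖W2 ξ‖ ^ 2 := (Lp.memLp W2).integrable_norm_pow (by norm_num)
  have hi3 : Integrable fun ξ => inner ℝ (W ξ) (V ξ) := L2.integrable_inner W V
  have hi12 : Integrable fun ξ => a * ‖W ξ‖ ^ 2 + 2 * l * ‖W2 ξ‖ ^ 2 :=
    (hi1.const_mul _).add (hi2.const_mul _)
  have hdiss : a * ‖W‖ ^ 2 + 2 * l * ‖W2‖ ^ 2 - (1 + 2 / a) * l ^ 2 * ‖W‖ ^ 2 ≤ 2 * inner ℝ W V := by
    rw [inner_eq_integral, norm_sq_eq_integral, norm_sq_eq_integral, ← integral_const_mul,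
      ← integral_const_mul, ← integral_const_mul, ← integral_const_mul,
      ← integral_add (hi1.const_mul _) (hi2.const_mul _),
      ← integral_sub hi12 (hi1.const_mul _)]
    apply integral_mono_ae (hi12.sub (hi1.const_mul _))
      (hi3.const_mul _)
    filter_upwards [hVc, hW2c] with ξ h1 h2
    have h3 : inner ℝ (W ξ) (V ξ) = (a + (2 * Real.pi * ξ) ^ 4) * ‖W ξ‖ ^ 2 := by
      rw [h1, ← Complex.real_smul, real_inner_smul_right, real_inner_self_eq_norm_sq]
    have h4 : ‖W2 ξ‖ ^ 2 = ρ ξ ^ 2 * ‖W ξ‖ ^ 2 := by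
      rw [h2, norm_mul, mul_pow, Complex.norm_real, Real.norm_eq_abs, sq_abs]
    simp only [Pi.sub_apply, h3, h4]
    have h5 := dissipation_bound ha hl (hρ ξ)
    have h6 := mul_le_mul_of_nonneg_right h5 (sq_nonneg ‖W ξ‖)
    have h7 : ((2 * Real.pi * ξ) ^ 2) ^ 2 = (2 * Real.pi * ξ) ^ 4 := by ring
    rw [h7] at h6
    linarith
  have hcs : -inner ℝ W2 G ≤ ‖G‖ * ‖W2‖ := by
    have := (abs_le.mp (abs_real_inner_le_norm W2 G)).1
    linarith [mul_comm ‖G‖ ‖W2‖]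
  rw [inner_neg_right, inner_add_right, hG]
  linarith

/-- The energy inequality in `H¹`. If the forcing `G` is bounded by `B ‖w‖₂`, then the growth rate
of `‖w‖₁²` is at most `-a + (1 + 2 / a) B²`. -/
theorem SolvesLinear.energy {a : ℝ} (ha : 0 < a) {w G : ℝ → L2} (h : SolvesLinear a w G)
    (hw : Continuous w) (hG : Continuous G) (hw1 : ∀ t, eSobolevSq 1 (w t) < ∞)
    (hc1 : Continuous fun t => sobolevNorm 1 (w t)) {s t : ℝ} (hs : 0 ≤ s) (hst : s ≤ t)
    (hw2 : ∫⁻ r in Set.Ioc s t, eSobolevSq 2 (w r) < ∞) {B : ℝ → ℝ} (hB0 : ∀ r, 0 ≤ B r)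
    (hB : IntervalIntegrable (fun r => B r ^ 2) volume s t)
    (hGB : ∀ᵐ r, r ∈ Set.Ioc s t → eSobolevSq 2 (w r) < ∞ → ‖G r‖ ≤ B r * sobolevNorm 2 (w r)) :
    sobolevNorm 1 (w t) ^ 2 ≤ sobolevNorm 1 (w s) ^ 2 *
      Real.exp (-a * (t - s) + (1 + 2 / a) * ∫ r in s..t, B r ^ 2) := by
  obtain ⟨ρ, hρ1, hρlim⟩ := exists_cutoffs
  set c := 1 + 2 / a with hc
  have hcpos : 0 < c := by positivity
  set Y : ℝ → ℝ := fun r => sobolevNorm 1 (w r) ^ 2 with hY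
  set Q : ℝ → ℝ := fun r => sobolevNorm 2 (w r) with hQ
  have hY0 : ∀ r, 0 ≤ Y r := fun r => sq_nonneg _
  have hYc : Continuous Y := hc1.pow 2
  have hQ0 : ∀ r, 0 ≤ Q r := fun r => sobolevNorm_nonneg _ _
  have hmeas2 := measurable_eSobolevSq_comp 2 hw
  have hQm : Measurable Q := hmeas2.ennreal_toReal.sqrt
  have hQi : IntegrableOn Q (Set.Ioc s t) := by
    have h1 : IntegrableOn (fun r => Q r ^ 2) (Set.Ioc s t) := by
      simp only [hQ, sobolevNorm_sq]
      exact integrable_toReal_of_lintegral_ne_top hmeas2.aemeasurable hw2.ne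
    refine Integrable.mono' (h1.add (integrableOn_const (C := (1 : ℝ)) (by simp)))
      hQm.aestronglyMeasurable ?_
    refine Eventually.of_forall fun r => ?_
    rw [Real.norm_of_nonneg (hQ0 r), Pi.add_apply]
    nlinarith [sq_nonneg (Q r - 1)]
  have hfin2 : ∀ᵐ r, r ∈ Set.Ioc s t → eSobolevSq 2 (w r) < ∞ := by
    rw [← ae_restrict_iff' measurableSet_Ioc]
    exact ae_lt_top hmeas2 hw2.ne
  -- `‖W n r‖` and `p n r` are truncations of the norms of order one and two of `w r`
  set W : ℕ → ℝ → CL2 := fun n r => mulS (schwartzOfReal (ρ n)) (fhat (w r)) with hW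
  set p : ℕ → ℝ → ℝ := fun n r => ‖mulS (schwartzOfReal (ρ n)) (W n r)‖ with hp
  have hWc : ∀ n, Continuous (W n) := fun n => by fun_prop
  have hpc : ∀ n, Continuous (p n) := fun n => by fun_prop
  have hWcoe : ∀ n r, ∀ᵐ ξ, W n r ξ = ((ρ n ξ : ℝ) : ℂ) * fhat (w r) ξ := fun n r =>
    mulS_coeFn _ _
  have hW2coe : ∀ n r, ∀ᵐ ξ, mulS (schwartzOfReal (ρ n)) (W n r) ξ =
      ((ρ n ξ ^ 2 : ℝ) : ℂ) * fhat (w r) ξ := by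
    intro n r
    filter_upwards [mulS_coeFn (schwartzOfReal (ρ n)) (W n r), hWcoe n r] with ξ h1 h2
    rw [h1, h2, schwartzOfReal_apply]; push_cast; ring
  have hpos : ∀ ξ : ℝ, 0 < 1 + (2 * Real.pi * ξ) ^ 2 := fun ξ => by positivity
  have hρ1' : ∀ n ξ, ρ n ξ ^ 2 ≤ (1 + (2 * Real.pi * ξ) ^ 2) ^ (1 : ℝ) := fun n ξ => by
    rw [Real.rpow_one]; exact hρ1 n ξ
  have hρ2' : ∀ n ξ, (ρ n ξ ^ 2) ^ 2 ≤ (1 + (2 * Real.pi * ξ) ^ 2) ^ (2 : ℝ) := fun n ξ => by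
    rw [Real.rpow_two]; exact pow_le_pow_left₀ (sq_nonneg _) (hρ1 n ξ) 2
  have hlim1 : ∀ ξ, Tendsto (fun n => ρ n ξ ^ 2) atTop (𝓝 (1 + (2 * Real.pi * ξ) ^ 2)) := by
    intro ξ
    have := (hρlim ξ).pow 2
    rwa [Real.sq_sqrt (hpos ξ).le] at this
  have hWlim : ∀ r, Tendsto (fun n => ‖W n r‖ ^ 2) atTop (𝓝 (Y r)) := fun r =>
    tendsto_norm_sq_sobolevNorm (hw1 r) (fun n => hWcoe n r) hρ1' fun ξ => by
      rw [Real.rpow_one]; exact hlim1 ξ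
  have hWle : ∀ n r, ‖W n r‖ ^ 2 ≤ Y r := fun n r =>
    pow_le_pow_left₀ (norm_nonneg _) (norm_le_sobolevNorm (hw1 r) (hWcoe n r) (hρ1' n)) 2
  have hplim : ∀ r, eSobolevSq 2 (w r) < ∞ → Tendsto (fun n => p n r) atTop (𝓝 (Q r)) := by
    intro r hr
    have h1 := tendsto_norm_sq_sobolevNorm (m := fun n ξ => ρ n ξ ^ 2) hr (fun n => hW2coe n r) hρ2'
      fun ξ => by rw [Real.rpow_two]; exact (hlim1 ξ).pow 2
    have h2 := h1.sqrt
    simp only [Real.sqrt_sq (norm_nonneg _), Real.sqrt_sq (sobolevNorm_nonneg _ _)] at h2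
    exact h2
  have hple : ∀ n r, eSobolevSq 2 (w r) < ∞ → p n r ≤ Q r := fun n r hr =>
    norm_le_sobolevNorm (m := fun ξ => ρ n ξ ^ 2) hr (hW2coe n r) (hρ2' n)
  have hp0 : ∀ n r, 0 ≤ p n r := fun n r => norm_nonneg _
  -- the error made by truncating the interaction term; it tends to `0` because `p n r → Q r`, also
  -- when `Q r = 0`, where the quotient is `0`
  set E : ℕ → ℝ → ℝ := fun n r =>
    Real.exp (a * r) * (2 * ‖G r‖ * (p n r - p n r ^ 2 / Q r)) with hE
  set K : ℝ → ℝ := fun r => c * B r ^ 2 * (Real.exp (a * r) * Y r) with hK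
  have hEb : ∀ n r, eSobolevSq 2 (w r) < ∞ →
      ‖E n r‖ ≤ Real.exp (a * r) * (2 * ‖G r‖) * Q r := by
    intro n r hr
    have h1 := hple n r hr
    have h2 : p n r ^ 2 / Q r ≤ p n r := by
      apply div_le_of_le_mul₀ (hQ0 r) (hp0 n r)
      nlinarith [hp0 n r]
    have h3 : 0 ≤ p n r ^ 2 / Q r := div_nonneg (sq_nonneg _) (hQ0 r)
    have h4 : 0 ≤ p n r - p n r ^ 2 / Q r := by linarith
    have h5 : 0 ≤ Real.exp (a * r) * (2 * ‖G r‖) := by positivity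
    have h6 : E n r = Real.exp (a * r) * (2 * ‖G r‖) * (p n r - p n r ^ 2 / Q r) := by
      rw [hE]; ring
    rw [h6, Real.norm_of_nonneg (mul_nonneg h5 h4)]
    exact mul_le_mul_of_nonneg_left (by linarith) h5
  have hcoef : Continuous fun r => Real.exp (a * r) * (2 * ‖G r‖) := by fun_prop
  have hbd : IntervalIntegrable (fun r => Real.exp (a * r) * (2 * ‖G r‖) * Q r) volume s t :=
    ((intervalIntegrable_iff_integrableOn_Ioc_of_le hst).mpr hQi).continuousOn_mul
      hcoef.continuousOn
  have hEm : ∀ n, Measurable (E n) := fun n => by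
    have h1 := (hpc n).measurable
    have h2 := hG.norm.measurable
    have h3 : Measurable fun r : ℝ => Real.exp (a * r) := by fun_prop
    exact h3.mul ((h2.const_mul 2).mul (h1.sub ((h1.pow_const 2).div hQm)))
  have hEi : ∀ n, IntervalIntegrable (E n) volume s t := fun n => by
    refine hbd.mono_fun (hEm n).aestronglyMeasurable ?_
    rw [Set.uIoc_of_le hst]
    refine (ae_restrict_iff' measurableSet_Ioc).mpr ?_
    filter_upwards [hfin2] with r hr hrm
    rw [Real.norm_of_nonneg (mul_nonneg (by positivity) (hQ0 r))]
    exact hEb n r (hr hrm)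
  have hElim : ∀ τ ∈ Set.Icc s t, Tendsto (fun n => ∫ r in s..τ, E n r) atTop (𝓝 0) := by
    intro τ hτ
    have hsub : Set.uIoc s τ ⊆ Set.Ioc s t := by
      rw [Set.uIoc_of_le hτ.1]; exact Set.Ioc_subset_Ioc_right hτ.2
    have h0 : (0 : ℝ) = ∫ r in s..τ, (0 : ℝ) := by simp
    rw [h0]
    refine intervalIntegral.tendsto_integral_filter_of_dominated_convergence
      (fun r => Real.exp (a * r) * (2 * ‖G r‖) * Q r)
      (Eventually.of_forall fun n => (hEm n).aestronglyMeasurable)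
      (Eventually.of_forall fun n => ?_) ?_ ?_
    · filter_upwards [hfin2] with r hr hrm
      exact hEb n r (hr (hsub hrm))
    · exact hbd.mono_set (by
        rw [Set.uIcc_of_le hst, Set.uIcc_of_le hτ.1]; exact Set.Icc_subset_Icc_right hτ.2)
    · filter_upwards [hfin2] with r hr hrm
      have h1 := hplim r (hr (hsub hrm))
      have h2 : Tendsto (fun n => E n r) atTop
          (𝓝 (Real.exp (a * r) * (2 * ‖G r‖ * (Q r - Q r ^ 2 / Q r)))) :=
        ((h1.sub ((h1.pow 2).div_const _)).const_mul _).const_mul _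
      have h3 : Q r - Q r ^ 2 / Q r = 0 := by
        rcases eq_or_ne (Q r) 0 with h | h
        · simp [h]
        · field_simp; ring
      rwa [h3, mul_zero, mul_zero] at h2
  have hKi : IntervalIntegrable K volume s t :=
    (hB.const_mul c).mul_continuousOn
      ((by fun_prop : Continuous fun r => Real.exp (a * r) * Y r).continuousOn)
  -- the truncated energy inequality, integrated in time
  have hstep : ∀ n, ∀ τ ∈ Set.Icc s t, Real.exp (a * τ) * ‖W n τ‖ ^ 2 ≤
      Real.exp (a * s) * ‖W n s‖ ^ 2 + (∫ r in s..τ, E n r) + ∫ r in s..τ, K r := by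
    intro n τ hτ
    set D : ℝ → ℝ := fun r => Real.exp (a * r) * (a * ‖W n r‖ ^ 2 + 2 * inner ℝ (W n r)
      (-(mulS ((a : ℂ) • schwartzOfReal (ρ n) + mulFreq4 (schwartzOfReal (ρ n))) (fhat (w r))
        + mulS (schwartzOfReal (ρ n)) (fhat (G r))))) with hD
    have hDc : Continuous D := by
      have h1 : Continuous fun r => -(mulS ((a : ℂ) • schwartzOfReal (ρ n)
          + mulFreq4 (schwartzOfReal (ρ n))) (fhat (w r))
          + mulS (schwartzOfReal (ρ n)) (fhat (G r))) := by fun_prop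
      have h2 : Continuous fun r => inner ℝ (W n r) (-(mulS ((a : ℂ) • schwartzOfReal (ρ n)
          + mulFreq4 (schwartzOfReal (ρ n))) (fhat (w r))
          + mulS (schwartzOfReal (ρ n)) (fhat (G r)))) := (hWc n).inner h1
      fun_prop
    have hsub : Set.uIcc s τ ⊆ Set.uIcc s t := by
      rw [Set.uIcc_of_le hst, Set.uIcc_of_le hτ.1]; exact Set.Icc_subset_Icc_right hτ.2
    have hder : ∀ r ∈ Set.Ioo s τ,
        HasDerivAt (fun r => Real.exp (a * r) * ‖W n r‖ ^ 2) (D r) r := by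
      intro r hr
      have h1 := (h.hasDerivAt_mulS hw hG (schwartzOfReal (ρ n)) (hs.trans_lt hr.1)).norm_sq
      have h2 : HasDerivAt (fun r => Real.exp (a * r)) (Real.exp (a * r) * (a * 1)) r :=
        ((hasDerivAt_id r).const_mul a).exp
      have h3 := h2.mul h1
      convert! h3 using 1
      rw [hD]; ring
    have hftc := intervalIntegral.integral_eq_sub_of_hasDerivAt_of_le hτ.1
      ((by fun_prop : Continuous fun r => Real.exp (a * r) * ‖W n r‖ ^ 2).continuousOn) hder
      (hDc.intervalIntegrable _ _)
    have hle : ∫ r in s..τ, D r ≤ ∫ r in s..τ, (E n r + K r) := by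
      rw [intervalIntegral.integral_of_le hτ.1, intervalIntegral.integral_of_le hτ.1]
      have hi : IntervalIntegrable (fun r => E n r + K r) volume s τ :=
        ((hEi n).add hKi).mono_set hsub
      apply setIntegral_mono_on_ae hDc.integrableOn_Ioc
        ((intervalIntegrable_iff_integrableOn_Ioc_of_le hτ.1).mp hi) measurableSet_Ioc
      filter_upwards [hfin2, hGB] with r hr hrB hrm
      have hrm' : r ∈ Set.Ioc s t := Set.Ioc_subset_Ioc_right hτ.2 hrm
      have h2 := hrB hrm' (hr hrm')
      -- this `l` makes the forcing term and the interpolated dissipation cancel in the limit; for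
      -- `Q r = 0` it is `0`, and `G r` vanishes by the bound
      set l := ‖G r‖ / Q r with hl
      have hl0 : 0 ≤ l := div_nonneg (norm_nonneg _) (hQ0 r)
      have hlB : l ≤ B r := div_le_of_le_mul₀ (hQ0 r) (hB0 r) h2
      have h3 := energy_truncated ha hl0 (ρ n) (hρ1 n) (fhat (w r)) (fhat (G r))
      rw [norm_fhat] at h3
      have h4 : 2 * ‖G r‖ * p n r - 2 * l * p n r ^ 2 = 2 * ‖G r‖ * (p n r - p n r ^ 2 / Q r) := by
        rw [hl]; ring
      have h5 : c * l ^ 2 * ‖W n r‖ ^ 2 ≤ c * B r ^ 2 * Y r := by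
        have := hWle n r
        gcongr
      have h6 : D r ≤ Real.exp (a * r) *
          (2 * ‖G r‖ * (p n r - p n r ^ 2 / Q r) + c * B r ^ 2 * Y r) := by
        apply mul_le_mul_of_nonneg_left _ (Real.exp_pos _).le
        exact h3.trans (by rw [← h4]; linarith)
      refine h6.trans (le_of_eq ?_)
      rw [hE, hK]; ring
    rw [intervalIntegral.integral_add ((hEi n).mono_set hsub) (hKi.mono_set hsub), hftc] at hle
    linarith
  have hgron : ∀ τ ∈ Set.Icc s t, Real.exp (a * τ) * Y τ ≤ Real.exp (a * s) * Y s +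
      ∫ r in s..τ, c * B r ^ 2 * (Real.exp (a * r) * Y r) := by
    intro τ hτ
    have h1 := ((hWlim τ).const_mul (Real.exp (a * τ)))
    have h2 := (((hWlim s).const_mul (Real.exp (a * s))).add (hElim τ hτ)).add_const
      (∫ r in s..τ, K r)
    rw [add_zero] at h2
    exact le_of_tendsto_of_tendsto' h1 h2 fun n => hstep n τ hτ
  have hfinal := gronwall_integral (z := fun r => Real.exp (a * r) * Y r) hst
    ((by fun_prop : Continuous fun r => Real.exp (a * r) * Y r).continuousOn)
    (hB.const_mul c) (fun r => by positivity) hgron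
  rw [intervalIntegral.integral_const_mul] at hfinal
  have h1 : Y t = Real.exp (-(a * t)) * (Real.exp (a * t) * Y t) := by
    rw [← mul_assoc, ← Real.exp_add]; simp
  change Y t ≤ Y s * _
  calc Y t = Real.exp (-(a * t)) * (Real.exp (a * t) * Y t) := h1
    _ ≤ Real.exp (-(a * t)) * (Real.exp (a * s) * Y s *
        Real.exp (c * ∫ r in s..t, B r ^ 2)) :=
      mul_le_mul_of_nonneg_left hfinal (Real.exp_pos _).le
    _ = Y s * (Real.exp (-(a * t)) * Real.exp (a * s) * Real.exp (c * ∫ r in s..t, B r ^ 2)) := by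
      ring
    _ = _ := by
      rw [← Real.exp_add, ← Real.exp_add]
      congr 2; ring

/-! ### Bounds for the nonlinearity -/

/-- The product of two `L²` functions, meaningful when the first one is bounded. -/
def mulL2 (f g : L2) : L2 := toL2 fun x => f x * g x

lemma mulL2_coeFn {f g : L2} {M : ℝ} (hf : ∀ᵐ x, |f x| ≤ M) :
    ∀ᵐ x, mulL2 f g x = f x * g x := by
  have hmem : MemLp (fun x => f x * g x) 2 volume :=
    (Lp.memLp g).of_le_mul (c := M) ((Lp.aestronglyMeasurable f).mul (Lp.aestronglyMeasurable g))
      (by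
        filter_upwards [hf] with x hx
        rw [norm_mul]
        exact mul_le_mul_of_nonneg_right hx (norm_nonneg _))
  rw [mulL2, toL2, dif_pos hmem]
  exact hmem.coeFn_toLp

lemma norm_mulL2_le {f g : L2} {M : ℝ} (hf : ∀ᵐ x, |f x| ≤ M) : ‖mulL2 f g‖ ≤ M * ‖g‖ := by
  apply Lp.norm_le_mul_norm_of_ae_le_mul
  filter_upwards [mulL2_coeFn (g := g) hf, hf] with x hx hfx
  rw [hx, norm_mul]
  exact mul_le_mul_of_nonneg_right hfx (norm_nonneg _)

lemma HasWeakDeriv.mulL2 {f f' g g' : L2} (hf : HasWeakDeriv f f') (hg : HasWeakDeriv g g') :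
    HasWeakDeriv (KSE.mulL2 f g) (KSE.mulL2 g f' + KSE.mulL2 f g') := by
  refine hf.mul hg (mulL2_coeFn hf.abs_le) ?_
  filter_upwards [Lp.coeFn_add (KSE.mulL2 g f') (KSE.mulL2 f g'), mulL2_coeFn (g := f') hg.abs_le,
    mulL2_coeFn (g := g') hf.abs_le] with x h1 h2 h3
  rw [h1, Pi.add_apply, h2, h3]; ring

lemma HasWeakDeriv.convection_eq {f f' : L2} (hf : HasWeakDeriv f f') :
    convection f = KSE.mulL2 f f' := by
  rw [convection, hf.weakDeriv_eq, KSE.mulL2]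

/-- Polarization: `u u_x - v v_x = (w g_x + g w_x) / 2` with `w = u - v` and `g = u + v`. -/
lemma convection_sub_eq {u u' v v' : L2} (hu : HasWeakDeriv u u') (hv : HasWeakDeriv v v') :
    convection u - convection v =
      (1 / 2 : ℝ) • (mulL2 (u - v) (u' + v') + mulL2 (u + v) (u' - v')) := by
  rw [hu.convection_eq, hv.convection_eq]
  apply Lp.ext
  filter_upwards [Lp.coeFn_sub (mulL2 u u') (mulL2 v v'), mulL2_coeFn (g := u') hu.abs_le,
    mulL2_coeFn (g := v') hv.abs_le, mulL2_coeFn (g := u' + v') (hu.sub hv).abs_le,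
    mulL2_coeFn (g := u' - v') (hu.add hv).abs_le, Lp.coeFn_sub u v, Lp.coeFn_add u v,
    Lp.coeFn_sub u' v', Lp.coeFn_add u' v',
    Lp.coeFn_smul (1 / 2 : ℝ) (mulL2 (u - v) (u' + v') + mulL2 (u + v) (u' - v')),
    Lp.coeFn_add (mulL2 (u - v) (u' + v')) (mulL2 (u + v) (u' - v'))]
    with x h1 h2 h3 h4 h5 h6 h7 h8 h9 h10 h11
  simp only [Pi.sub_apply, Pi.add_apply, Pi.smul_apply, smul_eq_mul] at *
  rw [h1, h10, h11, h2, h3, h4, h5, h6, h7, h8, h9]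
  ring

lemma norm_half_smul (f : L2) : ‖(1 / 2 : ℝ) • f‖ = 1 / 2 * ‖f‖ := by
  rw [norm_smul, Real.norm_of_nonneg (by norm_num)]

lemma norm_convection_sub_le {u u' v v' : L2} (hu : HasWeakDeriv u u') (hv : HasWeakDeriv v v') :
    ‖convection u - convection v‖ ≤ 1 / 2 * ((‖u - v‖ + ‖u' - v'‖) * ‖u' + v'‖
      + (‖u + v‖ + ‖u' + v'‖) * ‖u' - v'‖) := by
  rw [convection_sub_eq hu hv, norm_half_smul]
  have h1 := norm_mulL2_le (g := u' + v') (hu.sub hv).abs_le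
  have h2 := norm_mulL2_le (g := u' - v') (hu.add hv).abs_le
  have h3 := norm_add_le (mulL2 (u - v) (u' + v')) (mulL2 (u + v) (u' - v'))
  linarith

/-- For `H²` functions, `u u_x - v v_x` lies in `H¹`, with a bound that is bilinear in `u - v` and
`u + v`. -/
lemma exists_hasWeakDeriv_convection_sub {u u' u'' v v' v'' : L2} (hu : HasWeakDeriv u u')
    (hu' : HasWeakDeriv u' u'') (hv : HasWeakDeriv v v') (hv' : HasWeakDeriv v' v'') :
    ∃ F', HasWeakDeriv (convection u - convection v) F' ∧
      ‖F'‖ ≤ 1 / 2 * (2 * ((‖u' + v'‖ + ‖u'' + v''‖) * ‖u' - v'‖)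
        + (‖u - v‖ + ‖u' - v'‖) * ‖u'' + v''‖ + (‖u + v‖ + ‖u' + v'‖) * ‖u'' - v''‖) := by
  have hw := hu.sub hv
  have hg := hu.add hv
  have hw' := hu'.sub hv'
  have hg' := hu'.add hv'
  rw [convection_sub_eq hu hv]
  refine ⟨_, ((hw.mulL2 hg').add ((hg.mulL2 hw'))).const_smul (1 / 2), ?_⟩
  rw [norm_half_smul]
  have h1 := norm_mulL2_le (g := u' - v') hg'.abs_le
  have h2 := norm_mulL2_le (g := u'' + v'') hw.abs_le
  have h3 := norm_mulL2_le (g := u'' - v'') hg.abs_le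
  have h4 : mulL2 (u' - v') (u' + v') = mulL2 (u' + v') (u' - v') := by
    rw [mulL2, mulL2]; congr 1; funext x; ring
  rw [h4]
  have n1 := norm_add_le (mulL2 (u' + v') (u' - v') + mulL2 (u - v) (u'' + v''))
    (mulL2 (u' + v') (u' - v') + mulL2 (u + v) (u'' - v''))
  have n2 := norm_add_le (mulL2 (u' + v') (u' - v')) (mulL2 (u - v) (u'' + v''))
  have n3 := norm_add_le (mulL2 (u' + v') (u' - v')) (mulL2 (u + v) (u'' - v''))
  linarith

/-- The product rule for `ψ(t, ·) f`. -/
lemma HasWeakDeriv.psiMul {t : ℝ} (ht : 0 ≤ t) {f f' : L2} (hf : HasWeakDeriv f f') :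
    HasWeakDeriv (KSE.psiMul t f)
      (mulOp (psiDeriv t) (measurable_psiDeriv t) 1 (norm_psiDeriv_le ht) f + KSE.psiMul t f') := by
  refine hf.bdd_mul (hasDerivAt_psi t) (measurable_psiDeriv t) (norm_psi_le ht)
    (norm_psiDeriv_le ht) (psiMul_coeFn ht f) ?_
  filter_upwards [Lp.coeFn_add (mulOp (psiDeriv t) (measurable_psiDeriv t) 1 (norm_psiDeriv_le ht) f)
    (KSE.psiMul t f'), mulOp_coeFn (measurable_psiDeriv t) (norm_psiDeriv_le ht) f,
    psiMul_coeFn ht f'] with x h1 h2 h3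
  rw [h1, Pi.add_apply, h2, h3]

lemma norm_mulOp_le {m : ℝ → ℝ} (hm : Measurable m) {C : ℝ} (hC : ∀ x, ‖m x‖ ≤ C) (f : L2) :
    ‖mulOp m hm C hC f‖ ≤ C * ‖f‖ := by
  apply Lp.norm_le_mul_norm_of_ae_le_mul
  filter_upwards [mulOp_coeFn hm hC f] with x hx
  rw [hx, norm_mul]
  exact mul_le_mul_of_nonneg_right (hC x) (norm_nonneg _)

lemma norm_psiMul_le {t : ℝ} (ht : 0 ≤ t) (f : L2) : ‖psiMul t f‖ ≤ t * ‖f‖ := by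
  rw [psiMul_eq_mulOp ht]
  exact norm_mulOp_le _ _ f

lemma psiMul_add {t : ℝ} (ht : 0 ≤ t) (f g : L2) : psiMul t (f + g) = psiMul t f + psiMul t g := by
  simp only [psiMul_eq_mulOp ht, map_add]

lemma psiMul_sub {t : ℝ} (ht : 0 ≤ t) (f g : L2) : psiMul t (f - g) = psiMul t f - psiMul t g := by
  simp only [psiMul_eq_mulOp ht, map_sub]

lemma psiMul_smul {t : ℝ} (ht : 0 ≤ t) (c : ℝ) (f : L2) : psiMul t (c • f) = c • psiMul t f := by
  simp only [psiMul_eq_mulOp ht, map_smul]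

/-- In a product the weight may be moved onto either factor; this one puts it on the second. -/
lemma psiMul_mulL2_right {t : ℝ} (ht : 0 ≤ t) {f g : L2} {M : ℝ} (hf : ∀ᵐ x, |f x| ≤ M) :
    psiMul t (mulL2 f g) = mulL2 f (psiMul t g) := by
  apply Lp.ext
  filter_upwards [psiMul_coeFn ht (mulL2 f g), mulL2_coeFn (g := g) hf,
    mulL2_coeFn (g := psiMul t g) hf, psiMul_coeFn ht g] with x h1 h2 h3 h4
  rw [h1, h2, h3, h4]; ring

lemma psiMul_mulL2_left {t : ℝ} (ht : 0 ≤ t) {f g : L2} {M M' : ℝ} (hf : ∀ᵐ x, |f x| ≤ M)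
    (hψf : ∀ᵐ x, |psiMul t f x| ≤ M') : psiMul t (mulL2 f g) = mulL2 (psiMul t f) g := by
  apply Lp.ext
  filter_upwards [psiMul_coeFn ht (mulL2 f g), mulL2_coeFn (g := g) hf,
    mulL2_coeFn (g := g) hψf, psiMul_coeFn ht f] with x h1 h2 h3 h4
  rw [h1, h2, h3, h4]; ring

/-- In the weighted norm the weight can be moved onto `u + v`, since `ψ g_x = (ψ g)_x - ψ_x g`. -/
lemma norm_psiMul_convection_sub_le {t : ℝ} (ht : 0 ≤ t) {u u' v v' k : L2}
    (hu : HasWeakDeriv u u') (hv : HasWeakDeriv v v') (hk : HasWeakDeriv (psiMul t (u + v)) k) :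
    ‖psiMul t (convection u - convection v)‖ ≤ 1 / 2 * ((‖u - v‖ + ‖u' - v'‖) * (‖k‖ + ‖u + v‖)
      + (‖psiMul t (u + v)‖ + ‖k‖) * ‖u' - v'‖) := by
  have hw := hu.sub hv
  have hg := hu.add hv
  obtain ⟨D, hDn, hD⟩ : ∃ D : L2, ‖D‖ ≤ 1 * ‖u + v‖ ∧
      HasWeakDeriv (psiMul t (u + v)) (D + psiMul t (u' + v')) :=
    ⟨_, norm_mulOp_le _ (norm_psiDeriv_le ht) (u + v), hg.psiMul ht⟩
  have hkD : psiMul t (u' + v') = k - D := by rw [hk.unique hD]; abel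
  rw [convection_sub_eq hu hv, psiMul_smul ht, psiMul_add ht, psiMul_mulL2_right ht hw.abs_le,
    psiMul_mulL2_left ht hg.abs_le hk.abs_le, hkD, norm_half_smul]
  have h1 := norm_mulL2_le (g := k - D) hw.abs_le
  have h2 := norm_mulL2_le (g := u' - v') hk.abs_le
  have h3 := norm_add_le (mulL2 (u - v) (k - D)) (mulL2 (psiMul t (u + v)) (u' - v'))
  have h4 := norm_sub_le k D
  have h5 : (‖u - v‖ + ‖u' - v'‖) * ‖k - D‖ ≤ (‖u - v‖ + ‖u' - v'‖) * (‖k‖ + ‖u + v‖) :=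
    mul_le_mul_of_nonneg_left (by linarith) (by positivity)
  linarith

lemma norm_le_of_sobolevNorm_two {f g k : L2} (h : HasWeakDeriv f g) (h' : HasWeakDeriv g k) :
    ‖f‖ ≤ sobolevNorm 2 f ∧ ‖g‖ ≤ sobolevNorm 2 f ∧ ‖k‖ ≤ sobolevNorm 2 f := by
  have h1 := h.sobolevNorm_two_sq h'
  have h0 := sobolevNorm_nonneg 2 f
  refine ⟨?_, ?_, ?_⟩ <;> apply abs_le_of_sq_le_sq' _ h0 |>.2 <;> rw [h1] <;>
    nlinarith [sq_nonneg ‖f‖, sq_nonneg ‖g‖, sq_nonneg ‖k‖]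

/-- The bound of the nonlinearity behind the first estimate. -/
lemma norm_convection_sub_le_sobolevNorm {u v : L2} (hu : eSobolevSq 2 u < ∞)
    (hv : eSobolevSq 2 v < ∞) :
    ‖convection u - convection v‖ ≤
      4 * Real.sqrt (sobolevNorm 1 u ^ 2 + sobolevNorm 1 v ^ 2) * sobolevNorm 2 (u - v) := by
  obtain ⟨u', u'', h1, h2⟩ := exists_hasWeakDeriv_two hu
  obtain ⟨v', v'', h3, h4⟩ := exists_hasWeakDeriv_two hv
  obtain ⟨w0, w1, -⟩ := norm_le_of_sobolevNorm_two (h1.sub h3) (h2.sub h4)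
  have hp0 := sobolevNorm_nonneg 2 (u - v)
  set p := sobolevNorm 2 (u - v)
  set S := Real.sqrt (sobolevNorm 1 u ^ 2 + sobolevNorm 1 v ^ 2) with hS
  have hSq : S ^ 2 = ‖u‖ ^ 2 + ‖u'‖ ^ 2 + (‖v‖ ^ 2 + ‖v'‖ ^ 2) := by
    rw [hS, Real.sq_sqrt (by positivity), h1.sobolevNorm_one_sq, h3.sobolevNorm_one_sq]
  have hS0 : 0 ≤ S := Real.sqrt_nonneg _
  have hle : ∀ x : ℝ, x ^ 2 ≤ S ^ 2 → x ≤ S := fun x hx => (abs_le_of_sq_le_sq' hx hS0).2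
  have a1 : ‖u‖ ≤ S := hle _ (by rw [hSq]; nlinarith [sq_nonneg ‖u'‖, sq_nonneg ‖v‖, sq_nonneg ‖v'‖])
  have a2 : ‖u'‖ ≤ S := hle _ (by rw [hSq]; nlinarith [sq_nonneg ‖u‖, sq_nonneg ‖v‖, sq_nonneg ‖v'‖])
  have a3 : ‖v‖ ≤ S := hle _ (by rw [hSq]; nlinarith [sq_nonneg ‖u‖, sq_nonneg ‖u'‖, sq_nonneg ‖v'‖])
  have a4 : ‖v'‖ ≤ S := hle _ (by rw [hSq]; nlinarith [sq_nonneg ‖u‖, sq_nonneg ‖u'‖, sq_nonneg ‖v‖])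
  have g0 : ‖u + v‖ ≤ 2 * S := (norm_add_le _ _).trans (by linarith)
  have g1 : ‖u' + v'‖ ≤ 2 * S := (norm_add_le _ _).trans (by linarith)
  refine (norm_convection_sub_le h1 h3).trans ?_
  calc _ ≤ 1 / 2 * ((p + p) * (2 * S) + (2 * S + 2 * S) * p) := by gcongr
    _ = 4 * S * p := by ring

/-- The bound of the nonlinearity behind the second estimate: the difference of the nonlinear terms
lies in the weighted `H¹` space on which the projections converge uniformly. -/
lemma exists_norm_convection_sub_sub_proj_le (e : HilbertBasis ℕ ℝ L2) {δ : ℝ} (hδ : 0 < δ) :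
    ∃ T : ℝ, 0 < T ∧ ∃ N : ℕ, 1 ≤ N ∧ ∀ t, T ≤ t → ∀ u v : L2, eSobolevSq 2 u < ∞ →
      eSobolevSq 2 v < ∞ →
      ‖(convection u - convection v) - proj e N (convection u - convection v)‖ ≤
        18 * δ * Real.sqrt (sobolevNorm 2 u ^ 2 + sobolevNorm 2 v ^ 2
          + sobolevNorm 1 (psiMul t u) ^ 2 + sobolevNorm 1 (psiMul t v) ^ 2)
          * sobolevNorm 2 (u - v) := by
  obtain ⟨T, hT, N, hN, H⟩ := exists_norm_sub_proj_le e hδ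
  refine ⟨T, hT, N, hN, fun t ht u v hu hv => ?_⟩
  have ht0 : 0 ≤ t := hT.le.trans ht
  obtain ⟨u', u'', h1, h2⟩ := exists_hasWeakDeriv_two hu
  obtain ⟨v', v'', h3, h4⟩ := exists_hasWeakDeriv_two hv
  obtain ⟨w0, w1, w2⟩ := norm_le_of_sobolevNorm_two (h1.sub h3) (h2.sub h4)
  obtain ⟨ku, hku⟩ : ∃ k, HasWeakDeriv (psiMul t u) k := ⟨_, h1.psiMul ht0⟩
  obtain ⟨kv, hkv⟩ : ∃ k, HasWeakDeriv (psiMul t v) k := ⟨_, h3.psiMul ht0⟩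
  obtain ⟨F', hF', hF'n⟩ := exists_hasWeakDeriv_convection_sub h1 h2 h3 h4
  have hk : HasWeakDeriv (psiMul t (u + v)) (ku + kv) := by
    rw [psiMul_add ht0]; exact hku.add hkv
  have hψ := norm_psiMul_convection_sub_le ht0 h1 h3 hk
  have hF := norm_convection_sub_le h1 h3
  have hmain := H t ht _ _ hF'
  set p := sobolevNorm 2 (u - v)
  set S := Real.sqrt (sobolevNorm 2 u ^ 2 + sobolevNorm 2 v ^ 2
          + sobolevNorm 1 (psiMul t u) ^ 2 + sobolevNorm 1 (psiMul t v) ^ 2) with hS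
  have hSq : S ^ 2 = sobolevNorm 2 u ^ 2 + sobolevNorm 2 v ^ 2
      + (‖psiMul t u‖ ^ 2 + ‖ku‖ ^ 2) + (‖psiMul t v‖ ^ 2 + ‖kv‖ ^ 2) := by
    rw [hS, Real.sq_sqrt (by positivity), hku.sobolevNorm_one_sq, hkv.sobolevNorm_one_sq]
  have hS0 : 0 ≤ S := Real.sqrt_nonneg _
  have hp0 : 0 ≤ p := sobolevNorm_nonneg _ _
  have hle : ∀ x : ℝ, x ^ 2 ≤ S ^ 2 → x ≤ S := fun x hx => (abs_le_of_sq_le_sq' hx hS0).2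
  have q1 := sq_nonneg (sobolevNorm 2 u)
  have q2 := sq_nonneg (sobolevNorm 2 v)
  have q3 := sq_nonneg ‖psiMul t u‖
  have q4 := sq_nonneg ‖ku‖
  have q5 := sq_nonneg ‖psiMul t v‖
  have q6 := sq_nonneg ‖kv‖
  have b1 : sobolevNorm 2 u ≤ S := hle _ (by linarith)
  have b2 : sobolevNorm 2 v ≤ S := hle _ (by linarith)
  have b3 : ‖psiMul t u‖ ≤ S := hle _ (by linarith)
  have b4 : ‖ku‖ ≤ S := hle _ (by linarith)
  have b5 : ‖psiMul t v‖ ≤ S := hle _ (by linarith)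
  have b6 : ‖kv‖ ≤ S := hle _ (by linarith)
  obtain ⟨u0, u1, u2⟩ := norm_le_of_sobolevNorm_two h1 h2
  obtain ⟨v0, v1, v2⟩ := norm_le_of_sobolevNorm_two h3 h4
  have g0 : ‖u + v‖ ≤ 2 * S := (norm_add_le _ _).trans (by linarith)
  have g1 : ‖u' + v'‖ ≤ 2 * S := (norm_add_le _ _).trans (by linarith)
  have g2 : ‖u'' + v''‖ ≤ 2 * S := (norm_add_le _ _).trans (by linarith)
  have g3 : ‖psiMul t (u + v)‖ ≤ 2 * S := by
    rw [psiMul_add ht0]; exact (norm_add_le _ _).trans (by linarith)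
  have g4 : ‖ku + kv‖ ≤ 2 * S := (norm_add_le _ _).trans (by linarith)
  have c1 : ‖convection u - convection v‖ ≤ 4 * (S * p) := by
    refine hF.trans ?_
    calc _ ≤ 1 / 2 * ((p + p) * (2 * S) + (2 * S + 2 * S) * p) := by gcongr
      _ = _ := by ring
  have c2 : ‖F'‖ ≤ 8 * (S * p) := by
    refine hF'n.trans ?_
    calc _ ≤ 1 / 2 * (2 * ((2 * S + 2 * S) * p) + (p + p) * (2 * S) + (2 * S + 2 * S) * p) := by
          gcongr
      _ = _ := by ring
  have c3 : ‖psiMul t (convection u - convection v)‖ ≤ 6 * (S * p) := by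
    refine hψ.trans ?_
    calc _ ≤ 1 / 2 * ((p + p) * (2 * S + 2 * S) + (2 * S + 2 * S) * p) := by gcongr
      _ = _ := by ring
  calc _ ≤ δ * (4 * (S * p) + 8 * (S * p) + 6 * (S * p)) := hmain.trans (by gcongr)
    _ = _ := by ring

/-! ### Regular paths -/

/-- The path `u` on `[0, ∞)`, extended by the constant `u 0` to negative times, where nothing is
assumed of `u`. -/
def extendPath (u : ℝ → L2) (t : ℝ) : L2 := u (max t 0)

lemma extendPath_of_nonneg (u : ℝ → L2) {t : ℝ} (ht : 0 ≤ t) : extendPath u t = u t := by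
  rw [extendPath, max_eq_left ht]

namespace IsRegularPath

variable {u v : ℝ → L2}

lemma hasWeakDeriv (hu : IsRegularPath u) {t : ℝ} (ht : 0 ≤ t) :
    HasWeakDeriv (u t) (weakDeriv (u t)) :=
  hasWeakDeriv_weakDeriv (hu.mem t ht)

lemma hasWeakDeriv_extendPath (hu : IsRegularPath u) (t : ℝ) :
    HasWeakDeriv (extendPath u t) (weakDeriv (extendPath u t)) :=
  hu.hasWeakDeriv (le_max_right t 0)

lemma tendsto_norm_sub (hu : IsRegularPath u) {t₀ : ℝ} (ht₀ : 0 ≤ t₀) :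
    Tendsto (fun t => ‖u t - u t₀‖ ^ 2 + ‖weakDeriv (u t) - weakDeriv (u t₀)‖ ^ 2)
      (𝓝[Set.Ici 0] t₀) (𝓝 0) := by
  have h := (ENNReal.tendsto_toReal ENNReal.zero_ne_top).comp (hu.cont t₀ ht₀)
  rw [ENNReal.toReal_zero] at h
  refine h.congr' ?_
  filter_upwards [self_mem_nhdsWithin] with t ht
  rw [Function.comp_apply, ((hu.hasWeakDeriv ht).sub (hu.hasWeakDeriv ht₀)).eSobolevSq_one,
    ENNReal.toReal_ofReal (by positivity)]

lemma continuous_extendPath (hu : IsRegularPath u) : Continuous (extendPath u) := by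
  have h : ContinuousOn u (Set.Ici 0) := by
    intro t₀ ht₀
    rw [ContinuousWithinAt, tendsto_iff_norm_sub_tendsto_zero]
    refine squeeze_zero (fun _ => norm_nonneg _) (fun t => ?_)
      (by simpa using (hu.tendsto_norm_sub ht₀).sqrt)
    exact Real.le_sqrt_of_sq_le (le_add_of_nonneg_right (by positivity))
  exact h.comp_continuous (by fun_prop) fun t => le_max_right t 0

lemma continuous_weakDeriv_extendPath (hu : IsRegularPath u) :
    Continuous fun t => weakDeriv (extendPath u t) := by
  have h : ContinuousOn (fun t => weakDeriv (u t)) (Set.Ici 0) := by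
    intro t₀ ht₀
    rw [ContinuousWithinAt, tendsto_iff_norm_sub_tendsto_zero]
    refine squeeze_zero (fun _ => norm_nonneg _) (fun t => ?_)
      (by simpa using (hu.tendsto_norm_sub ht₀).sqrt)
    exact Real.le_sqrt_of_sq_le (le_add_of_nonneg_left (by positivity))
  exact h.comp_continuous (f := fun t : ℝ => max t 0) (by fun_prop) fun t => le_max_right t 0

lemma continuous_convection (hu : IsRegularPath u) :
    Continuous fun t => convection (extendPath u t) := by
  have h1 := hu.continuous_extendPath
  have h2 := hu.continuous_weakDeriv_extendPath
  rw [continuous_iff_continuousAt]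
  intro t₀
  rw [ContinuousAt, tendsto_iff_norm_sub_tendsto_zero]
  refine squeeze_zero (fun _ => norm_nonneg _) (fun t => norm_convection_sub_le
    (hu.hasWeakDeriv_extendPath t) (hu.hasWeakDeriv_extendPath t₀)) ?_
  refine Continuous.tendsto' (by fun_prop) _ _ ?_
  simp

lemma continuous_sobolevNorm_one_sq (hu : IsRegularPath u) :
    Continuous fun t => sobolevNorm 1 (extendPath u t) ^ 2 := by
  have h1 := hu.continuous_extendPath
  have h2 := hu.continuous_weakDeriv_extendPath
  simp_rw [fun t => (hu.hasWeakDeriv_extendPath t).sobolevNorm_one_sq]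
  fun_prop

lemma continuous_sobolevNorm_one_sub (hu : IsRegularPath u) (hv : IsRegularPath v) :
    Continuous fun t => sobolevNorm 1 (extendPath u t - extendPath v t) := by
  have h1 := hu.continuous_extendPath
  have h2 := hu.continuous_weakDeriv_extendPath
  have h3 := hv.continuous_extendPath
  have h4 := hv.continuous_weakDeriv_extendPath
  have h : ∀ t, sobolevNorm 1 (extendPath u t - extendPath v t) =
      Real.sqrt (‖extendPath u t - extendPath v t‖ ^ 2 +
        ‖weakDeriv (extendPath u t) - weakDeriv (extendPath v t)‖ ^ 2) := fun t => by
    rw [← ((hu.hasWeakDeriv_extendPath t).sub (hv.hasWeakDeriv_extendPath t)).sobolevNorm_one_sq,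
      Real.sqrt_sq (sobolevNorm_nonneg _ _)]
  simp_rw [h]
  fun_prop

/-! ### Time integrability of the norms along a path -/

lemma lintegral_eSobolevSq_two_lt_top (hu : IsRegularPath u) {s t : ℝ} (hs : 0 ≤ s) :
    ∫⁻ r in Set.Ioc s t, eSobolevSq 2 (extendPath u r) < ∞ := by
  refine lt_of_le_of_lt ?_ (hu.sq_integrable t)
  rw [setLIntegral_congr_fun (g := fun r => eSobolevSq 2 (u r)) measurableSet_Ioc fun r hr => by
    simp only [extendPath_of_nonneg u (hs.trans hr.1.le)]]
  exact lintegral_mono_set (Set.Ioc_subset_Ioc_left hs)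

lemma ae_eSobolevSq_two_lt_top (hu : IsRegularPath u) {s t : ℝ} (hs : 0 ≤ s) :
    ∀ᵐ r, r ∈ Set.Ioc s t → eSobolevSq 2 (extendPath u r) < ∞ :=
  (ae_restrict_iff' measurableSet_Ioc).mp (ae_lt_top
    (measurable_eSobolevSq_comp 2 hu.continuous_extendPath)
    (hu.lintegral_eSobolevSq_two_lt_top hs).ne)

lemma intervalIntegrable_of_extendPath {q : ℝ → L2 → ℝ} {s t : ℝ} (hs : 0 ≤ s) (hst : s ≤ t)
    (h : IntervalIntegrable (fun r => q r (extendPath u r)) volume s t) :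
    IntervalIntegrable (fun r => q r (u r)) volume s t :=
  h.congr fun r hr => by
    rw [Set.uIoc_of_le hst] at hr
    simp only [extendPath_of_nonneg u (hs.trans hr.1.le)]

lemma intervalIntegrable_sobolevNorm_one_sq (hu : IsRegularPath u) {s t : ℝ} (hs : 0 ≤ s)
    (hst : s ≤ t) : IntervalIntegrable (fun r => sobolevNorm 1 (u r) ^ 2) volume s t :=
  intervalIntegrable_of_extendPath (q := fun _ f => sobolevNorm 1 f ^ 2) hs hst
    (hu.continuous_sobolevNorm_one_sq.intervalIntegrable _ _)

lemma intervalIntegrable_sobolevNorm_two_sq (hu : IsRegularPath u) {s t : ℝ} (hs : 0 ≤ s)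
    (hst : s ≤ t) : IntervalIntegrable (fun r => sobolevNorm 2 (u r) ^ 2) volume s t := by
  refine intervalIntegrable_of_extendPath (q := fun _ f => sobolevNorm 2 f ^ 2) hs hst ?_
  simp_rw [sobolevNorm_sq]
  rw [intervalIntegrable_iff_integrableOn_Ioc_of_le hst]
  exact integrable_toReal_of_lintegral_ne_top
    (measurable_eSobolevSq_comp 2 hu.continuous_extendPath).aemeasurable
    (hu.lintegral_eSobolevSq_two_lt_top hs).ne

end IsRegularPath

/-- The weight is Lipschitz in time. -/
lemma abs_psi_sub_le {s t : ℝ} (hs : 0 ≤ s) (ht : 0 ≤ t) (x : ℝ) :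
    |psi t x - psi s x| ≤ |t - s| := by
  wlog hst : s ≤ t generalizing s t
  · rw [abs_sub_comm, abs_sub_comm t]
    exact this ht hs (le_of_not_ge hst)
  have h := phi_pos x
  have h1 : psi t x - psi s x = Real.exp (-(s / phi x)) * psi (t - s) x := by
    have h2 : Real.exp (-(t / phi x)) = Real.exp (-(s / phi x)) * Real.exp (-((t - s) / phi x)) := by
      rw [← Real.exp_add]
      congr 1
      ring
    rw [psi, psi, psi, h2]
    ring
  have h3 : Real.exp (-(s / phi x)) ≤ 1 :=
    Real.exp_le_one_iff.mpr (neg_nonpos.mpr (div_nonneg hs h.le))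
  have h4 := psi_nonneg (sub_nonneg.mpr hst) x
  rw [h1, abs_of_nonneg (by positivity), abs_of_nonneg (sub_nonneg.mpr hst)]
  exact (mul_le_of_le_one_left h4 h3).trans (psi_le _ _)

lemma norm_psiMul_sub_le {s t : ℝ} (hs : 0 ≤ s) (ht : 0 ≤ t) (f g : L2) :
    ‖psiMul t f - psiMul s g‖ ≤ |t - s| * ‖f‖ + s * ‖f - g‖ := by
  have h1 : ‖psiMul t f - psiMul s f‖ ≤ |t - s| * ‖f‖ := by
    apply Lp.norm_le_mul_norm_of_ae_le_mul
    filter_upwards [Lp.coeFn_sub (psiMul t f) (psiMul s f), psiMul_coeFn ht f, psiMul_coeFn hs f]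
      with x h1 h2 h3
    rw [h1, Pi.sub_apply, h2, h3, ← sub_mul, norm_mul]
    exact mul_le_mul_of_nonneg_right (abs_psi_sub_le hs ht x) (norm_nonneg _)
  have h2 := norm_psiMul_le hs (f - g)
  rw [psiMul_sub hs] at h2
  have h3 : psiMul t f - psiMul s g = (psiMul t f - psiMul s f) + (psiMul s f - psiMul s g) := by
    abel
  rw [h3]
  exact (norm_add_le _ _).trans (add_le_add h1 h2)

lemma HasWeakDeriv.sobolevNorm_one_psiMul_sq_le {t : ℝ} (ht : 0 ≤ t) {f f' : L2}
    (hf : HasWeakDeriv f f') :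
    sobolevNorm 1 (KSE.psiMul t f) ^ 2 ≤ (t * ‖f‖) ^ 2 + (‖f‖ + t * ‖f'‖) ^ 2 := by
  rw [(hf.psiMul ht).sobolevNorm_one_sq]
  have h1 := norm_psiMul_le ht f
  have h2 := norm_psiMul_le ht f'
  have h3 := norm_mulOp_le (measurable_psiDeriv t) (norm_psiDeriv_le ht) f
  have h4 := norm_add_le (mulOp (psiDeriv t) (measurable_psiDeriv t) 1 (norm_psiDeriv_le ht) f)
    (KSE.psiMul t f')
  gcongr
  linarith

lemma IsRegularPath.intervalIntegrable_sobolevNorm_psiMul_sq {u : ℝ → L2} (hu : IsRegularPath u)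
    {s t : ℝ} (hs : 0 ≤ s) (hst : s ≤ t) :
    IntervalIntegrable (fun r => sobolevNorm 1 (psiMul r (u r)) ^ 2) volume s t := by
  have hc := hu.continuous_extendPath
  have hc' := hu.continuous_weakDeriv_extendPath
  have hψ : Continuous fun r => psiMul (max r 0) (extendPath u r) := by
    rw [continuous_iff_continuousAt]
    intro r₀
    rw [ContinuousAt, tendsto_iff_norm_sub_tendsto_zero]
    refine squeeze_zero (fun _ => norm_nonneg _) (fun r => norm_psiMul_sub_le
      (le_max_right r₀ 0) (le_max_right r 0) (extendPath u r) (extendPath u r₀)) ?_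
    refine Continuous.tendsto' (by fun_prop) _ _ ?_
    simp
  have hb : Continuous fun r => (max r 0 * ‖extendPath u r‖) ^ 2 +
      (‖extendPath u r‖ + max r 0 * ‖weakDeriv (extendPath u r)‖) ^ 2 := by fun_prop
  have hint : IntervalIntegrable (fun r => sobolevNorm 1 (psiMul (max r 0) (extendPath u r)) ^ 2)
      volume s t := by
    refine (hb.intervalIntegrable s t).mono_fun' ?_ (Eventually.of_forall fun r => ?_)
    · simp_rw [sobolevNorm_sq]
      exact (measurable_eSobolevSq_comp 1 hψ).ennreal_toReal.aestronglyMeasurable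
    · dsimp only
      rw [Real.norm_of_nonneg (by positivity)]
      exact (hu.hasWeakDeriv_extendPath r).sobolevNorm_one_psiMul_sq_le (le_max_right r 0)
  refine hint.congr fun r hr => ?_
  rw [Set.uIoc_of_le hst] at hr
  have hr0 := hs.trans hr.1.le
  simp only [extendPath_of_nonneg u hr0, max_eq_left hr0]

/-! ### The equation of the difference -/

lemma integral_sub_mul (f g : L2) {m : ℝ → ℝ} (hm : MemLp m 2 volume) :
    ∫ x, (f - g : L2) x * m x = (∫ x, f x * m x) - ∫ x, g x * m x := by
  rw [← integral_sub (integrable_coeFn_mul f hm) (integrable_coeFn_mul g hm)]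
  apply integral_congr_ae
  filter_upwards [Lp.coeFn_sub f g] with x hx
  rw [hx, Pi.sub_apply, sub_mul]

lemma memLp_iteratedDeriv_four (φ : 𝓢(ℝ, ℝ)) : MemLp (iteratedDeriv 4 φ) 2 volume := by
  rw [iteratedDeriv_four_eq]
  exact SchwartzMap.memLp _ 2 volume

/-- The noise and the forcing cancel in the difference of the two equations. -/
lemma SolvesKSE.solvesLinear_sub {a : ℝ} {h : L2} {W u v : ℝ → L2} {Q : L2 →L[ℝ] L2}
    (hu : SolvesKSE a h W 0 u)
    (hv : SolvesKSE a h W (fun t => Q (convection (u t) - convection (v t))) v) :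
    SolvesLinear a (fun t => extendPath u t - extendPath v t) fun t =>
      (convection (extendPath u t) - convection (extendPath v t)) -
        Q (convection (extendPath u t) - convection (extendPath v t)) := by
  intro φ t ht
  obtain ⟨ru, eu⟩ := hu
  obtain ⟨rv, ev⟩ := hv
  have hm : MemLp φ 2 volume := φ.memLp 2 volume
  have hm4 := memLp_iteratedDeriv_four φ
  have cu := ru.continuous_extendPath
  have cv := rv.continuous_extendPath
  have ccu := ru.continuous_convection
  have ccv := rv.continuous_convection
  have hz : ∫ x, (0 : L2) x * φ x = 0 := by
    have := integral_sub_mul 0 0 hm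
    rwa [sub_zero, sub_self] at this
  have hci : ∀ {m : ℝ → ℝ} {f : ℝ → L2}, MemLp m 2 volume → Continuous f →
      Continuous fun r => ∫ x, f r x * m x := fun hm hf => (continuous_integral_mul hm).comp hf
  have eut := eu φ t ht
  have evt := ev φ t ht
  rw [intervalIntegral.integral_congr (g := fun r => a * (∫ x, extendPath u r x * φ x) +
    (∫ x, extendPath u r x * iteratedDeriv 4 φ x) +
    ∫ x, convection (extendPath u r) x * φ x) fun r hr => by
      rw [Set.uIcc_of_le ht] at hr
      simp only [extendPath_of_nonneg u hr.1, Pi.zero_apply, hz, add_zero]] at eut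
  rw [intervalIntegral.integral_congr (g := fun r => a * (∫ x, extendPath v r x * φ x) +
    (∫ x, extendPath v r x * iteratedDeriv 4 φ x) +
    (∫ x, convection (extendPath v r) x * φ x) +
    ∫ x, (Q (convection (extendPath u r) - convection (extendPath v r))) x * φ x) fun r hr => by
      rw [Set.uIcc_of_le ht] at hr
      simp only [extendPath_of_nonneg u hr.1, extendPath_of_nonneg v hr.1]] at evt
  simp only [integral_sub_mul _ _ hm, integral_sub_mul _ _ hm4]
  rw [extendPath_of_nonneg u ht, extendPath_of_nonneg v ht, extendPath_of_nonneg u le_rfl,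
    extendPath_of_nonneg v le_rfl, eut, evt]
  have hU : Continuous fun r => a * (∫ x, extendPath u r x * φ x) +
      (∫ x, extendPath u r x * iteratedDeriv 4 φ x) + ∫ x, convection (extendPath u r) x * φ x :=
    (((hci hm cu).const_mul a).add (hci hm4 cu)).add (hci hm ccu)
  have hV : Continuous fun r => a * (∫ x, extendPath v r x * φ x) +
      (∫ x, extendPath v r x * iteratedDeriv 4 φ x) +
      (∫ x, convection (extendPath v r) x * φ x) +
      ∫ x, (Q (convection (extendPath u r) - convection (extendPath v r))) x * φ x :=
    ((((hci hm cv).const_mul a).add (hci hm4 cv)).add (hci hm ccv)).add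
      (hci hm (Q.continuous.comp (ccu.sub ccv)))
  have hI := intervalIntegral.integral_sub (hU.intervalIntegrable (μ := volume) 0 t)
    (hV.intervalIntegrable 0 t)
  rw [add_sub_add_right_eq_sub, add_sub_add_right_eq_sub, sub_sub_sub_comm, ← hI]
  congr 1
  exact intervalIntegral.integral_congr fun r _ => by ring

/-- The energy inequality for the difference of the two solutions, given a bound of the difference
of the nonlinear terms by its norm of order two. -/
lemma SolvesKSE.energy_sub {a : ℝ} (ha : 0 < a) {h : L2} {W u v : ℝ → L2} {Q : L2 →L[ℝ] L2}
    (hu : SolvesKSE a h W 0 u)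
    (hv : SolvesKSE a h W (fun t => Q (convection (u t) - convection (v t))) v)
    {s t : ℝ} (hs : 0 ≤ s) (hst : s ≤ t) {B : ℝ → ℝ} (hB0 : ∀ r, 0 ≤ B r)
    (hB : IntervalIntegrable (fun r => B r ^ 2) volume s t)
    (hF : ∀ r, s ≤ r → eSobolevSq 2 (u r) < ∞ → eSobolevSq 2 (v r) < ∞ →
      ‖convection (u r) - convection (v r) - Q (convection (u r) - convection (v r))‖ ≤
        B r * sobolevNorm 2 (u r - v r)) :
    sobolevNorm 1 (u t - v t) ^ 2 ≤ sobolevNorm 1 (u s - v s) ^ 2 *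
      Real.exp (-a * (t - s) + (1 + 2 / a) * ∫ r in s..t, B r ^ 2) := by
  have ru := hu.1
  have rv := hv.1
  have hd := ru.continuous_convection.sub rv.continuous_convection
  have hmem (r : ℝ) : eSobolevSq 1 (extendPath u r - extendPath v r) < ∞ :=
    ((ru.hasWeakDeriv_extendPath r).sub (rv.hasWeakDeriv_extendPath r)).eSobolevSq_one_lt_top
  have hw2 : ∫⁻ r in Set.Ioc s t, eSobolevSq 2 (extendPath u r - extendPath v r) < ∞ := by
    refine lt_of_le_of_lt (lintegral_mono fun r => eSobolevSq_sub_le 2 _ _) ?_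
    rw [lintegral_const_mul' _ _ (by norm_num), lintegral_add_left
      (measurable_eSobolevSq_comp 2 ru.continuous_extendPath)]
    exact ENNReal.mul_lt_top (by norm_num) (ENNReal.add_lt_top.mpr
      ⟨ru.lintegral_eSobolevSq_two_lt_top hs, rv.lintegral_eSobolevSq_two_lt_top hs⟩)
  have key := (hu.solvesLinear_sub hv).energy ha
    (ru.continuous_extendPath.sub rv.continuous_extendPath)
    (hd.sub (Q.continuous.comp hd)) hmem (ru.continuous_sobolevNorm_one_sub rv) hs hst hw2 hB0 hB
    (by
      filter_upwards [ru.ae_eSobolevSq_two_lt_top (t := t) hs,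
        rv.ae_eSobolevSq_two_lt_top (t := t) hs] with r h1 h2 hr _
      have hr0 := hs.trans hr.1.le
      specialize h1 hr
      specialize h2 hr
      rw [extendPath_of_nonneg u hr0] at h1 ⊢
      rw [extendPath_of_nonneg v hr0] at h2 ⊢
      exact hF r hr.1.le h1 h2)
  simpa only [extendPath_of_nonneg u hs, extendPath_of_nonneg v hs,
    extendPath_of_nonneg u (hs.trans hst), extendPath_of_nonneg v (hs.trans hst)] using key

/-- Since `1 - P_N` is a contraction, the plain bound of the nonlinearity applies. -/
lemma SolvesKSE.sobolevNorm_sub_sq_le {a : ℝ} (ha : 0 < a) {h : L2} {W u v : ℝ → L2}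
    {e : HilbertBasis ℕ ℝ L2} {N : ℕ} (hu : SolvesKSE a h W 0 u)
    (hv : SolvesKSE a h W (fun t => proj e N (convection (u t) - convection (v t))) v)
    {s t : ℝ} (hs : 0 ≤ s) (hst : s ≤ t) :
    sobolevNorm 1 (u t - v t) ^ 2 ≤ sobolevNorm 1 (u s - v s) ^ 2 *
      Real.exp (-a * (t - s) + 16 * (1 + 2 / a) * ∫ r in s..t,
        (sobolevNorm 1 (u r) ^ 2 + sobolevNorm 1 (v r) ^ 2)) := by
  have hsq : ∀ r, (4 * Real.sqrt (sobolevNorm 1 (u r) ^ 2 + sobolevNorm 1 (v r) ^ 2)) ^ 2 =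
      16 * (sobolevNorm 1 (u r) ^ 2 + sobolevNorm 1 (v r) ^ 2) := fun r => by
    rw [mul_pow, Real.sq_sqrt (by positivity)]
    norm_num
  have key := hu.energy_sub ha hv hs hst
    (B := fun r => 4 * Real.sqrt (sobolevNorm 1 (u r) ^ 2 + sobolevNorm 1 (v r) ^ 2))
    (fun r => by positivity)
    (by
      simp_rw [hsq]
      exact ((hu.1.intervalIntegrable_sobolevNorm_one_sq hs hst).add
        (hv.1.intervalIntegrable_sobolevNorm_one_sq hs hst)).const_mul 16)
    fun r _ h1 h2 => (norm_sub_proj_le e N _).trans (norm_convection_sub_le_sobolevNorm h1 h2)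
  simp_rw [hsq, intervalIntegral.integral_const_mul] at key
  convert key using 3
  ring

/-- For late times and large `N` the difference of the nonlinear terms, projected by `1 - P_N`, is
small relative to the weighted norms of the solutions. -/
lemma exists_sobolevNorm_sub_sq_le {a : ℝ} (ha : 0 < a) (e : HilbertBasis ℕ ℝ L2) {ε : ℝ}
    (hε : 0 < ε) :
    ∃ T : ℝ, 0 < T ∧ ∃ N : ℕ, 1 ≤ N ∧ ∀ (h : L2) (W u v : ℝ → L2), SolvesKSE a h W 0 u →
      SolvesKSE a h W (fun t => proj e N (convection (u t) - convection (v t))) v →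
      ∀ s t : ℝ, T ≤ s → s ≤ t →
        sobolevNorm 1 (u t - v t) ^ 2 ≤ sobolevNorm 1 (u s - v s) ^ 2 *
          Real.exp (-a * (t - s) + 324 * (1 + 2 / a) * ε * ∫ r in s..t,
            (sobolevNorm 2 (u r) ^ 2 + sobolevNorm 2 (v r) ^ 2 +
              sobolevNorm 1 (psiMul r (u r)) ^ 2 + sobolevNorm 1 (psiMul r (v r)) ^ 2)) := by
  obtain ⟨T, hT, N, hN, hbound⟩ := exists_norm_convection_sub_sub_proj_le e (Real.sqrt_pos.mpr hε)
  refine ⟨T, hT, N, hN, fun h W u v hu hv s t hTs hst => ?_⟩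
  have hs : 0 ≤ s := hT.le.trans hTs
  set S : ℝ → ℝ := fun r => sobolevNorm 2 (u r) ^ 2 + sobolevNorm 2 (v r) ^ 2 +
    sobolevNorm 1 (psiMul r (u r)) ^ 2 + sobolevNorm 1 (psiMul r (v r)) ^ 2 with hS
  have hsq : ∀ r, (18 * Real.sqrt ε * Real.sqrt (S r)) ^ 2 = 324 * ε * S r := fun r => by
    rw [mul_pow, mul_pow, Real.sq_sqrt hε.le, Real.sq_sqrt (by positivity)]
    norm_num
  have key := hu.energy_sub ha hv hs hst (B := fun r => 18 * Real.sqrt ε * Real.sqrt (S r))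
    (fun r => by positivity)
    (by
      simp_rw [hsq]
      exact ((((hu.1.intervalIntegrable_sobolevNorm_two_sq hs hst).add
        (hv.1.intervalIntegrable_sobolevNorm_two_sq hs hst)).add
        (hu.1.intervalIntegrable_sobolevNorm_psiMul_sq hs hst)).add
        (hv.1.intervalIntegrable_sobolevNorm_psiMul_sq hs hst)).const_mul (324 * ε))
    fun r hr h1 h2 => hbound r (hTs.trans hr) (u r) (v r) h1 h2
  simp_rw [hsq, intervalIntegral.integral_const_mul] at key
  convert key using 3
  ring

end

end KSE

theorem theorem3p1 (a : ℝ) (ha : 0 < a) :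
    (∃ C : ℝ, 0 < C ∧
      ∀ (e : HilbertBasis ℕ ℝ KSE.L2) (N : ℕ), 1 ≤ N →
      ∀ (b : ℕ → ℝ) (h : KSE.L2)
        (Ω : Type*) [MeasurableSpace Ω] (P : Measure Ω) [IsProbabilityMeasure P]
        (β : ℕ → ℝ≥0 → Ω → ℝ) (u v : ℝ → Ω → KSE.L2),
        KSE.IsCoupledPair P a e N b h β u v →
        ∀ᵐ ω ∂P, ∀ s t : ℝ, 0 ≤ s → s ≤ t →
          KSE.sobolevNorm 1 (u t ω - v t ω) ^ 2 ≤
            KSE.sobolevNorm 1 (u s ω - v s ω) ^ 2 *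
              Real.exp (-a * (t - s) + C * ∫ r in s..t,
                (KSE.sobolevNorm 1 (u r ω) ^ 2 + KSE.sobolevNorm 1 (v r ω) ^ 2))) ∧
    (∃ Cstar : ℝ, 0 < Cstar ∧
      ∀ (e : HilbertBasis ℕ ℝ KSE.L2) (ε : ℝ), 0 < ε →
      ∃ T : ℝ, 0 < T ∧ ∃ N : ℕ, 1 ≤ N ∧
      ∀ (b : ℕ → ℝ) (h : KSE.L2)
        (Ω : Type*) [MeasurableSpace Ω] (P : Measure Ω) [IsProbabilityMeasure P]
        (β : ℕ → ℝ≥0 → Ω → ℝ) (u v : ℝ → Ω → KSE.L2),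
        KSE.IsCoupledPair P a e N b h β u v →
        ∀ᵐ ω ∂P, ∀ s t : ℝ, 0 ≤ s → s ≤ t →
          KSE.sobolevNorm 1 (u (t + T) ω - v (t + T) ω) ^ 2 ≤
            KSE.sobolevNorm 1 (u (s + T) ω - v (s + T) ω) ^ 2 *
              Real.exp (-a * (t - s) + Cstar * ε * ∫ r in (s + T)..(t + T),
                (KSE.sobolevNorm 2 (u r ω) ^ 2 + KSE.sobolevNorm 2 (v r ω) ^ 2
                  + KSE.sobolevNorm 1 (KSE.psiMul r (u r ω)) ^ 2
                  + KSE.sobolevNorm 1 (KSE.psiMul r (v r ω)) ^ 2))) := by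
  refine ⟨⟨16 * (1 + 2 / a), by positivity, ?_⟩, 324 * (1 + 2 / a), by positivity, ?_⟩
  · intro e N _ b h Ω _ P _ β u v H
    filter_upwards [H.solves_u, H.solves_v] with ω hu hv s t hs hst
    exact hu.sobolevNorm_sub_sq_le ha hv hs hst
  · intro e ε hε
    obtain ⟨T, hT, N, hN, key⟩ := KSE.exists_sobolevNorm_sub_sq_le ha e hε
    refine ⟨T, hT, N, hN, fun b h Ω _ P _ β u v H => ?_⟩
    filter_upwards [H.solves_u, H.solves_v] with ω hu hv s t hs hst
    have := key h _ _ _ hu hv (s + T) (t + T) (by linarith) (by linarith)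
    rwa [add_sub_add_right_eq_sub] at this
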